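/- Let $K\ge 3$ and let $E_K$ be the open regular polygon with $K$ edges centred at the origin, with vertices $w_k=(\cos(2\pi k/K),\sin(2\pi k/K))$, $k\in\mathbb Z$ (indices modulo $K$), and edges $[w_k,w_{k+1}]$. Fix $s>0$ and $0<d<\sin(\pi/K)$ (half the edge length). Let $n_k$ be the unit vector $(w_{k+1}-w_k)/|w_{k+1}-w_k|$. Let $\mathbf P_b$ be the following field of symmetric traceless $2\times2$ matrices on $\partial E_K$: on the edge $[w_k,w_{k+1}]$, at distance at least $d$ from both of its end points, $\mathbf P_b=\mathbf A_k:=2s\,(n_k\otimes n_k-\tfrac12\mathbf I_2)$; at the vertex $w_k$, $\mathbf P_b=\tfrac12(\mathbf A_{k-1}+\mathbf A_k)$; on the part of an edge within distance $d$ of one of its end points, $\mathbf P_b$ is the linear interpolation between the value at that vertex and the value on that edge. Then the boundary-value problem $$\Delta P_{11}=0,\quad \Delta P_{12}=0\ \text{ in }E_K,\qquad \begin{pmatrix}P_{11}&P_{12}\\P_{12}&-P_{11}\end{pmatrix}=\mathbf P_b\ \text{ on }\partial E_K$$ has exactly one solution $\mathbf P_R=(P_{11},P_{12})$ that is continuous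 on $\overline{E_K}$ and $C^2$ in $E_K$, and it has the following properties. 1. $P_{11}(0,0)=P_{12}(0,0)=0$. 2. If $K\ne4$, then $\mathbf P_R(x,y)\neq(0,0)$ for every $(x,y)\in\overline{E_K}\setminus\{(0,0)\}$. 3. If $K=4$, then $\mathbf P_R$ is the Well Order Reconstruction Solution in the limit of vanishing domain size: with $\hat{\mathbf x}=(1,1)/\sqrt2$ and $\hat{\mathbf y}=(-1,1)/\sqrt2$ (the directions of the edges of the square) and with $X$, $Y$ the coordinates along them, the matrix is $q\,(\hat{\mathbf x}\otimes\hat{\mathbf x}-\hat{\mathbf y}\otimes\hat{\mathbf y})$ on $\overline{E_4}$, where the scalar function $q$ is continuous on $\overline{E_4}$, harmonic in $E_4$, zero on both diagonals of the square, and satisfies $(Y^2-X^2)\,q\ge0$. In particular $\mathbf P_R=(0,0)$ on both diagonals. -/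

import Mathlib

noncomputable section

namespace NematicPolygon

/-- The vertices of the regular polygon with `K` edges inscribed in the unit circle, numbered
counterclockwise from `(1, 0)` and indexed periodically by `ℤ`. A point `(x, y)` of the plane is
the complex number `x + i y`. -/
def vertex (K : ℕ) (k : ℤ) : ℂ :=
  ⟨Real.cos (2 * Real.pi * k / K), Real.sin (2 * Real.pi * k / K)⟩

/-- The closed regular polygon. -/
def closedPolygon (K : ℕ) : Set ℂ := convexHull ℝ (Set.range (vertex K))

/-- The open regular polygon `E_K`. -/
def polygon (K : ℕ) : Set ℂ := interior (closedPolygon K)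

/-- The edge from vertex `k` to vertex `k + 1`. -/
def edge (K : ℕ) (k : ℤ) : Set ℂ := segment ℝ (vertex K k) (vertex K (k + 1))

/-- The unit vector tangent to the edge from vertex `k` to vertex `k + 1`. -/
def tangent (K : ℕ) (k : ℤ) : ℂ :=
  ‖vertex K (k + 1) - vertex K k‖⁻¹ • (vertex K (k + 1) - vertex K k)

/-- The matrix `n ⊗ n` of a plane vector `n`. -/
def outer (n : ℂ) : Matrix (Fin 2) (Fin 2) ℝ :=
  Matrix.vecMulVec ![n.re, n.im] ![n.re, n.im]

/-- The tensor `2 s (n ⊗ n - I / 2)` with order parameter `s` and director `n`. -/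
def directorTensor (s : ℝ) (n : ℂ) : Matrix (Fin 2) (Fin 2) ℝ :=
  (2 * s) • (outer n - (1 / 2 : ℝ) • (1 : Matrix (Fin 2) (Fin 2) ℝ))

/-- The symmetric traceless matrix with entries `P₁₁` and `P₁₂`. -/
def pTensor (a b : ℝ) : Matrix (Fin 2) (Fin 2) ℝ := !![a, b; b, -a]

/-- The tangent value on the edge from vertex `k` to vertex `k + 1`. -/
def edgeValue (K : ℕ) (s : ℝ) (k : ℤ) : Matrix (Fin 2) (Fin 2) ℝ :=
  directorTensor s (tangent K k)

/-- The value at vertex `k`: the average of the values on the two edges that meet there. -/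
def vertexValue (K : ℕ) (s : ℝ) (k : ℤ) : Matrix (Fin 2) (Fin 2) ℝ :=
  (1 / 2 : ℝ) • (edgeValue K s (k - 1) + edgeValue K s k)

/-- The boundary datum `P_b` at a point `z` of the edge from vertex `k` to vertex `k + 1`: within
distance `d` of a vertex it interpolates linearly between the value at that vertex and the value
on the edge; elsewhere it is the value on the edge. -/
def boundaryTensor (K : ℕ) (s d : ℝ) (k : ℤ) (z : ℂ) : Matrix (Fin 2) (Fin 2) ℝ :=
  if dist z (vertex K k) ≤ d then
    (1 - dist z (vertex K k) / d) • vertexValue K s k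
      + (dist z (vertex K k) / d) • edgeValue K s k
  else if dist z (vertex K (k + 1)) ≤ d then
    (1 - dist z (vertex K (k + 1)) / d) • vertexValue K s (k + 1)
      + (dist z (vertex K (k + 1)) / d) • edgeValue K s k
  else edgeValue K s k

/-- `(P₁₁, P₁₂)` is a classical solution of the limiting boundary-value problem:
`Δ P₁₁ = Δ P₁₂ = 0` in `E_K`, and `P = P_b` on `∂E_K`. -/
structure IsSolution (K : ℕ) (s d : ℝ) (P₁₁ P₁₂ : ℂ → ℝ) : Prop where
  continuousOn₁₁ : ContinuousOn P₁₁ (closedPolygon K)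
  continuousOn₁₂ : ContinuousOn P₁₂ (closedPolygon K)
  harmonic₁₁ : InnerProductSpace.HarmonicOnNhd P₁₁ (polygon K)
  harmonic₁₂ : InnerProductSpace.HarmonicOnNhd P₁₂ (polygon K)
  boundary : ∀ k : ℤ, ∀ z ∈ edge K k, pTensor (P₁₁ z) (P₁₂ z) = boundaryTensor K s d k z

/-- The union of the two diagonals of the square `E_4`. -/
def squareDiagonals : Set ℂ :=
  segment ℝ (vertex 4 0) (vertex 4 2) ∪ segment ℝ (vertex 4 1) (vertex 4 3)

/-- The first axis parallel to edges of `E_4`. -/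
def axisX : ℂ := ⟨1 / Real.sqrt 2, 1 / Real.sqrt 2⟩

/-- The second axis parallel to edges of `E_4`. -/
def axisY : ℂ := ⟨-(1 / Real.sqrt 2), 1 / Real.sqrt 2⟩

/-- The limiting (`λ = 0`) Well Order Reconstruction Solution on the square `E_4`: in the frame of
the edge directions it has the form `q (x̂ ⊗ x̂ - ŷ ⊗ ŷ)` with a single scalar degree of freedom
`q`, so that its eigenvectors are constant; `q` is harmonic (the Allen-Cahn equation at `λ = 0`),
vanishes on the diagonals, and satisfies `(Y² - X²) q ≥ 0` in the coordinates `X`, `Y` of that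
frame. -/
def IsLimitingWORS (P₁₁ P₁₂ : ℂ → ℝ) : Prop :=
  ∃ q : ℂ → ℝ,
    ContinuousOn q (closedPolygon 4) ∧
    InnerProductSpace.HarmonicOnNhd q (polygon 4) ∧
    (∀ z ∈ closedPolygon 4, pTensor (P₁₁ z) (P₁₂ z) = q z • (outer axisX - outer axisY)) ∧
    (∀ z ∈ squareDiagonals, q z = 0) ∧
    ∀ z ∈ closedPolygon 4, 0 ≤ ((inner ℝ axisY z) ^ 2 - (inner ℝ axisX z) ^ 2) * q z

end NematicPolygon

end

noncomputable section

namespace NematicPolygon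

open InnerProductSpace Metric Set Filter Topology ComplexConjugate

/-! Encode the matrix as the complex number `P₁₁ + i P₁₂`; a director `n` of order `s` becomes `s
n²`. With `p = π / K` and `β = 2p`, the function `v = -(P₁₁ + i P₁₂)` is harmonic and equals `s
exp(i(2k+1)β)` on the middle of edge `k`, whose normal has argument `(2k+1)p`.

Existence transports the Poisson integral on the disc to the polygon by the Schwarz-Christoffel map,
which is a homeomorphism of the closed disc onto the closed polygon (`exists_harmonic_disc`,
`image_polygonMap`, `exists_harmonic_polygon`). Uniqueness is the minimum principle.

For the zeros, uniqueness makes `v` equivariant under the reflections of the polygon: `v(R_m z) =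
exp(2imβ) conj(v z)`. Two of these force `v 0 = 0`, and on the ray of argument `mp` the value is a
real multiple of `exp(imβ)`. In the sector of half-width `p` around argument `jp`, consider the
component `f_j` of `v` along `exp(ijβ)`. On the boundary of the polygon `f_j ≥ s cos² β`; on the
bounding rays `m = j ± 1` it equals `cos β · f_m`, and such a ray is the axis of sector `m`. So a
lower bound `-A` common to all sectors improves to `-(cos β) A` by the minimum principle
(`component_lower_bound_step`). Iterating gives `f_j ≥ 0` when `0 ≤ cos β < 1`, and the strong
principle gives `f_j > 0` in open sectors when `cos β > 0` (`component_pos`). The open sectors cover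
the punctured polygon.

For `K ≥ 5` this applies with `β = 2p`. For `K = 3` that cosine is negative, but the conjugate of
the datum is of the same form with `β = p`; hence `β` is a free parameter. For `K = 4`, `cos β = 0`:
one entry vanishes identically, and `f_j ≥ 0` is the sign property of the other. -/

/-! ### Minimum principles and reflections of harmonic functions. -/

theorem exists_analyticAt_re_eq {h : ℂ → ℝ} {z : ℂ} (hh : HarmonicAt h z) :
    ∃ F : ℂ → ℂ, AnalyticAt ℂ F z ∧ (fun w => (F w).re) =ᶠ[𝓝 z] h := by
  obtain ⟨r, hr, hball⟩ := Metric.eventually_nhds_iff_ball.1 hh.eventually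
  obtain ⟨F, hF, hFe⟩ := HarmonicOnNhd.exists_analyticOnNhd_ball_re_eq (f := h) (z := z) (R := r) hball
  exact ⟨F, hF z (mem_ball_self hr), hFe.eventuallyEq_of_mem (ball_mem_nhds z hr)⟩

/-- If `h = Re F` near `z`, then `|exp(-F)| = exp(-h)` has a local maximum, and the maximum modulus
principle applies. -/
theorem eventually_eq_of_isLocalMin {h : ℂ → ℝ} {z : ℂ} (hh : HarmonicAt h z)
    (hm : IsLocalMin h z) : ∀ᶠ w in 𝓝 z, h w = h z := by
  obtain ⟨F, hF, hFe⟩ := exists_analyticAt_re_eq hh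
  have hG : AnalyticAt ℂ (fun w => Complex.exp (-F w)) z := hF.neg.cexp
  have hd : ∀ᶠ w in 𝓝 z, DifferentiableAt ℂ (fun w => Complex.exp (-F w)) w :=
    hG.eventually_analyticAt.mono fun w hw => hw.differentiableAt
  have hmax : IsLocalMax (norm ∘ fun w => Complex.exp (-F w)) z := by
    filter_upwards [hm, hFe] with w hw hw'
    simp only [Function.comp_apply, Complex.norm_exp, Complex.neg_re]
    have h0 : (F z).re = h z := hFe.self_of_nhds
    rw [hw', h0]
    gcongr
  filter_upwards [Complex.norm_eventually_eq_of_isLocalMax hd hmax, hFe] with w hw hw'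
  simp only [Complex.norm_exp, Complex.neg_re, Real.exp_eq_exp, neg_inj] at hw
  rw [← hw', hw]
  exact hFe.self_of_nhds

/-- Weak minimum principle: a function continuous on a compact set `S` and harmonic on an open
subset `U` is bounded below on `S` by its lower bounds on `S \ U`. -/
theorem le_of_harmonic_of_le_diff {S U : Set ℂ} (hS : IsCompact S) (hU : IsOpen U) (hUS : U ⊆ S)
    {h : ℂ → ℝ} (hc : ContinuousOn h S) (hh : HarmonicOnNhd h U) {m : ℝ}
    (hm : ∀ z ∈ S \ U, m ≤ h z) {z : ℂ} (hz : z ∈ S) : m ≤ h z := by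
  by_contra hlt
  push Not at hlt
  obtain ⟨z₀, hz₀, hmin⟩ := hS.exists_isMinOn ⟨z, hz⟩ hc
  -- This is the compact set of minimisers. Its point of largest real part would lie in `U`, where
  -- `h` is locally constant, so that a point slightly to the right would also be a minimiser.
  have hM : IsCompact (S ∩ h ⁻¹' Iic (h z₀)) :=
    hS.of_isClosed_subset (hc.preimage_isClosed_of_isClosed hS.isClosed isClosed_Iic)
      inter_subset_left
  obtain ⟨z₁, hz₁, hmax⟩ := hM.exists_isMaxOn ⟨z₀, hz₀, le_refl (h z₀)⟩ Complex.continuous_re.continuousOn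
  have hz₁U : z₁ ∈ U := by
    by_contra hn
    have h1 := hm z₁ ⟨hz₁.1, hn⟩
    have h2 : h z₁ ≤ h z₀ := hz₁.2
    have h3 : h z₀ ≤ h z := hmin hz
    linarith
  have hloc : IsLocalMin h z₁ := by
    filter_upwards [hU.mem_nhds hz₁U] with w hw
    exact le_trans hz₁.2 (hmin (hUS hw))
  have hev := (eventually_eq_of_isLocalMin (hh z₁ hz₁U) hloc).and (hU.mem_nhds hz₁U)
  have hcont : Tendsto (fun t : ℝ => z₁ + t) (𝓝[>] 0) (𝓝 z₁) := by
    have : Continuous fun t : ℝ => z₁ + t := by fun_prop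
    simpa using (this.tendsto 0).mono_left nhdsWithin_le_nhds
  obtain ⟨t, ⟨h1, h2⟩, h3⟩ := ((hcont.eventually hev).and self_mem_nhdsWithin).exists
  have h4 : (z₁ + t).re ≤ z₁.re := hmax ⟨hUS h2, by
    change h (z₁ + t) ≤ h z₀
    rw [h1]
    exact hz₁.2⟩
  simp at h4
  have : (0 : ℝ) < t := h3
  linarith

/-- Strong minimum principle: each zero is a local minimum, so the zero set is open as well as
relatively closed in the connected set `U`. -/
theorem eq_zero_of_harmonic_of_nonneg {U : Set ℂ} (hU : IsOpen U) (hUc : IsPreconnected U)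
    {h : ℂ → ℝ} (hh : HarmonicOnNhd h U) (hnn : ∀ z ∈ U, 0 ≤ h z) {z₀ : ℂ} (hz₀ : z₀ ∈ U)
    (h0 : h z₀ = 0) {z : ℂ} (hz : z ∈ U) : h z = 0 := by
  let V : Set ℂ := {z | z ∈ U ∧ h z = 0}
  have hV : IsOpen V := by
    rw [isOpen_iff_mem_nhds]
    rintro w ⟨hw, hw0⟩
    have hloc : IsLocalMin h w := by
      filter_upwards [hU.mem_nhds hw] with x hx
      rw [hw0]
      exact hnn x hx
    filter_upwards [eventually_eq_of_isLocalMin (hh w hw) hloc, hU.mem_nhds hw] with x hx hxU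
    exact ⟨hxU, hx.trans hw0⟩
  refine (hUc.subset_of_closure_inter_subset hV ⟨z₀, hz₀, hz₀, h0⟩ ?_ hz).2
  rintro w ⟨hwV, hwU⟩
  refine ⟨hwU, ?_⟩
  have hcw : ContinuousAt h w := (hh w hwU).1.continuousAt
  have hcl := mem_closure_iff_frequently.1 hwV
  have : h w ∈ closure ({0} : Set ℝ) := by
    rw [mem_closure_iff_frequently]
    exact hcw.tendsto.frequently (hcl.mono fun x hx => hx.2)
  simpa using this

/-- If `h = Re F`, then `w ↦ conj (F (a * conj w))` is holomorphic with the required real part. For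
`|a| = 1` this covers reflections in lines through the origin. -/
theorem harmonicAt_comp_mul_conj {h : ℂ → ℝ} (a : ℂ) {z : ℂ} (hh : HarmonicAt h (a * conj z)) :
    HarmonicAt (fun w => h (a * conj w)) z := by
  obtain ⟨F, hF, hFe⟩ := exists_analyticAt_re_eq hh
  have hcont : Tendsto (fun w : ℂ => a * conj w) (𝓝 z) (𝓝 (a * conj z)) :=
    (by fun_prop : Continuous fun w : ℂ => a * conj w).tendsto z
  have hG : AnalyticAt ℂ (fun w => conj (F (a * conj w))) z := by
    rw [Complex.analyticAt_iff_eventually_differentiableAt]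
    filter_upwards [hcont.eventually hF.eventually_analyticAt] with w hw
    have h1 : DifferentiableAt ℂ (fun x => F (a * x)) (conj w) :=
      hw.differentiableAt.comp (conj w) (by fun_prop)
    have := h1.conj_conj
    simpa [Function.comp_def] using this
  refine (harmonicAt_congr_nhds ?_).1 hG.harmonicAt_re
  filter_upwards [hcont.eventually hFe] with w hw
  simpa using hw

theorem harmonicAt_complex_iff {v : ℂ → ℂ} {z : ℂ} :
    HarmonicAt v z ↔ HarmonicAt (fun w => (v w).re) z ∧ HarmonicAt (fun w => (v w).im) z := by
  constructor
  · intro h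
    exact ⟨h.comp_CLM Complex.reCLM, h.comp_CLM Complex.imCLM⟩
  · rintro ⟨h1, h2⟩
    have h3 := (h1.comp_CLM Complex.ofRealCLM).add
      (h2.comp_CLM (Complex.I • Complex.ofRealCLM : ℝ →L[ℝ] ℂ))
    refine (harmonicAt_congr_nhds ?_).1 h3
    filter_upwards with w
    simp only [Pi.add_apply, Function.comp_apply]
    apply Complex.ext <;> simp

theorem harmonicAt_complex_comp_mul_conj {v : ℂ → ℂ} (a : ℂ) {z : ℂ}
    (hv : HarmonicAt v (a * conj z)) : HarmonicAt (fun w => v (a * conj w)) z := by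
  rw [harmonicAt_complex_iff] at hv ⊢
  exact ⟨harmonicAt_comp_mul_conj (h := fun w => (v w).re) a hv.1,
    harmonicAt_comp_mul_conj (h := fun w => (v w).im) a hv.2⟩

/-- The real part of `b * v` is harmonic when `v` is. -/
theorem HarmonicOnNhd.re_mul {v : ℂ → ℂ} {U : Set ℂ} (hv : HarmonicOnNhd v U) (b : ℂ) :
    HarmonicOnNhd (fun z => (b * v z).re) U :=
  hv.comp_CLM (Complex.reCLM.comp (ContinuousLinearMap.mul ℝ ℂ b))

/-! ### The Dirichlet problem on the disc. -/

/-- The Herglotz-Riesz transform of `g` on the unit circle. -/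
def herglotz (g : ℂ → ℝ) (w : ℂ) : ℂ :=
  Real.circleAverage (fun ζ => herglotzRieszKernel 0 w ζ • (g ζ : ℂ)) 0 1

theorem analyticOnNhd_herglotz {g : ℂ → ℝ} (hg : ContinuousOn g (sphere 0 1)) :
    AnalyticOnNhd ℂ (herglotz g) (ball 0 1) := by
  have h : ContinuousOn (fun ζ => (g ζ : ℂ)) (sphere 0 1) :=
    Complex.continuous_ofReal.comp_continuousOn hg
  exact analyticOnNhd_circleAverage_herglotzRieszKernel_smul (h.circleIntegrable zero_le_one)

/-- The Poisson kernel is positive and reproduces `q`, so harmonic majorants on the circle remain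
majorants inside. -/
theorem re_herglotz_le {g q : ℂ → ℝ} (hg : ContinuousOn g (sphere 0 1))
    (hq : HarmonicOnNhd q (closedBall 0 1)) (hle : ∀ ζ ∈ sphere (0 : ℂ) 1, g ζ ≤ q ζ) {w : ℂ}
    (hw : w ∈ ball (0 : ℂ) 1) : (herglotz g w).re ≤ q w := by
  have hk : ContinuousOn (Complex.re ∘ herglotzRieszKernel 0 w) (sphere 0 1) := by
    have := continuousOn_herglotzRieszKernel_sphere hw
    rw [abs_one] at this
    exact Complex.continuous_re.comp_continuousOn this
  have hqc : ContinuousOn q (sphere 0 1) := hq.continuousOn.mono sphere_subset_closedBall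
  rw [herglotz, re_circleAverage_herglotzRieszKernel_smul (hg.circleIntegrable zero_le_one) hw,
    ← hq.circleAverage_poissonKernel_smul hw, poissonKernel_eq_re_herglotzRieszKernel]
  refine Real.circleAverage_mono ((hk.mul hg).circleIntegrable zero_le_one)
    ((hk.mul hqc).circleIntegrable zero_le_one) fun ζ hζ => ?_
  rw [abs_one] at hζ
  have hpos : 0 ≤ (herglotzRieszKernel 0 w ζ).re := by
    refine le_trans ?_ (le_re_herglotzRieszKernel hζ hw)
    rw [mem_ball_zero_iff] at hw
    rw [sub_zero]
    exact div_nonneg (by linarith) (by positivity)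
  exact mul_le_mul_of_nonneg_left (hle ζ hζ) hpos

theorem herglotz_neg (g : ℂ → ℝ) (w : ℂ) : herglotz (fun ζ => -g ζ) w = -herglotz g w := by
  simp [herglotz, Real.circleAverage]

theorem harmonicOnNhd_affine (a : ℝ) (b : ℂ) (U : Set ℂ) :
    HarmonicOnNhd (fun z => a + (b * z).re) U := fun z _ => by
  have : AnalyticAt ℂ (fun z => (a : ℂ) + b * z) z := by fun_prop
  simpa using this.harmonicAt_re

theorem norm_sub_sq_of_mem_sphere {ζ ξ : ℂ} (hζ : ‖ζ‖ = 1) (hξ : ‖ξ‖ = 1) :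
    ‖ζ - ξ‖ ^ 2 = 2 - 2 * (conj ξ * ζ).re := by
  have h1 : ‖ζ‖ ^ 2 = 1 := by rw [hζ, one_pow]
  have h2 : ‖ξ‖ ^ 2 = 1 := by rw [hξ, one_pow]
  rw [← Complex.normSq_eq_norm_sq, Complex.normSq_apply] at h1 h2 ⊢
  simp
  linarith

theorem abs_sub_le_add_mul_norm_sq {g : ℂ → ℝ} (hg : ContinuousOn g (sphere 0 1)) {ξ : ℂ}
    (hξ : ξ ∈ sphere (0 : ℂ) 1) {ε : ℝ} (hε : 0 < ε) :
    ∃ C : ℝ, ∀ ζ ∈ sphere (0 : ℂ) 1, |g ζ - g ξ| ≤ ε + C * ‖ζ - ξ‖ ^ 2 := by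
  obtain ⟨M, hM⟩ := (isCompact_sphere (0 : ℂ) 1).exists_bound_of_continuousOn hg
  obtain ⟨δ, hδ, hδg⟩ := Metric.continuousOn_iff.1 hg ξ hξ ε hε
  have hM0 : 0 ≤ M := (norm_nonneg _).trans (hM ξ hξ)
  refine ⟨2 * M / δ ^ 2, fun ζ hζ => ?_⟩
  by_cases hd : dist ζ ξ < δ
  · have h1 := hδg ζ hζ hd
    rw [Real.dist_eq] at h1
    have : 0 ≤ 2 * M / δ ^ 2 * ‖ζ - ξ‖ ^ 2 := by positivity
    linarith
  · rw [not_lt, dist_eq_norm] at hd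
    have h1 : |g ζ - g ξ| ≤ 2 * M := by
      have := norm_sub_le (g ζ) (g ξ)
      rw [Real.norm_eq_abs] at this
      linarith [hM ζ hζ, hM ξ hξ]
    have h2 : 2 * M ≤ 2 * M / δ ^ 2 * ‖ζ - ξ‖ ^ 2 := by
      rw [div_mul_eq_mul_div, le_div_iff₀ (by positivity)]
      gcongr
    linarith

/-- The Dirichlet problem on the unit disc. -/
theorem exists_harmonic_disc {g : ℂ → ℝ} (hg : ContinuousOn g (sphere 0 1)) :
    ∃ (h : ℂ → ℝ) (H : ℂ → ℂ), ContinuousOn h (closedBall 0 1) ∧ AnalyticOnNhd ℂ H (ball 0 1) ∧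
      (∀ z ∈ ball (0 : ℂ) 1, h z = (H z).re) ∧ ∀ z ∈ sphere (0 : ℂ) 1, h z = g z := by
  classical
  let h : ℂ → ℝ := fun z => if ‖z‖ < 1 then (herglotz g z).re else g z
  have hball : ∀ z ∈ ball (0 : ℂ) 1, h z = (herglotz g z).re := fun z hz =>
    if_pos (by simpa using hz)
  have hsph : ∀ z ∈ sphere (0 : ℂ) 1, h z = g z := fun z hz =>
    if_neg (by rw [mem_sphere_zero_iff_norm] at hz; simp [hz])
  refine ⟨h, herglotz g, ?_, analyticOnNhd_herglotz hg, hball, hsph⟩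
  intro z hz
  rcases (mem_closedBall_zero_iff.1 hz).lt_or_eq with hlt | heq
  · have hz' : z ∈ ball (0 : ℂ) 1 := mem_ball_zero_iff.2 hlt
    have h1 : ContinuousAt (fun w => (herglotz g w).re) z :=
      Complex.continuous_re.continuousAt.comp (analyticOnNhd_herglotz hg z hz').continuousAt
    refine ContinuousAt.continuousWithinAt (h1.congr ?_)
    filter_upwards [isOpen_ball.mem_nhds hz'] with w hw
    exact (hball w hw).symm
  · have hzs : z ∈ sphere (0 : ℂ) 1 := mem_sphere_zero_iff_norm.2 heq
    rw [Metric.continuousWithinAt_iff']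
    intro ε hε
    obtain ⟨C, hC⟩ := abs_sub_le_add_mul_norm_sq hg hzs (half_pos hε)
    have hq : ∀ a : ℝ, ∀ c : ℝ, ∀ ζ : ℂ, a + c * (2 - 2 * (conj z * ζ).re) =
        (a + 2 * c) + ((-(2 * c) * conj z : ℂ) * ζ).re := fun a c ζ => by
      have : (-(2 * c) * conj z : ℂ) * ζ = ((-(2 * c) : ℝ) : ℂ) * (conj z * ζ) := by
        push_cast; ring
      rw [this, Complex.re_ofReal_mul]
      ring
    -- The barrier: on the circle `‖ζ - z‖ ^ 2` coincides with the affine, hence harmonic, function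
    -- `2 - 2 Re (conj z * ζ)`. The estimate `hC` is therefore a harmonic bound and carries over to
    -- the interior, and the barrier vanishes at `z`.
    have key : ∀ w ∈ closedBall (0 : ℂ) 1,
        |h w - g z| ≤ ε / 2 + C * (2 - 2 * (conj z * w).re) := by
      intro w hw
      rcases (mem_closedBall_zero_iff.1 hw).lt_or_eq with hwlt | hweq
      · have hw' : w ∈ ball (0 : ℂ) 1 := mem_ball_zero_iff.2 hwlt
        rw [hball w hw', abs_le]
        constructor
        · have h1 := re_herglotz_le (g := fun ζ => -g ζ) hg.neg
            (harmonicOnNhd_affine ((ε / 2 - g z) + 2 * C) (-(2 * C) * conj z) _)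
            (fun ζ hζ => by
              rw [← hq, ← norm_sub_sq_of_mem_sphere (mem_sphere_zero_iff_norm.1 hζ) heq]
              have := (abs_le.1 (hC ζ hζ)).1
              linarith) hw'
          rw [← hq, herglotz_neg, Complex.neg_re] at h1
          linarith
        · have h1 := re_herglotz_le hg
            (harmonicOnNhd_affine ((ε / 2 + g z) + 2 * C) (-(2 * C) * conj z) _)
            (fun ζ hζ => by
              rw [← hq, ← norm_sub_sq_of_mem_sphere (mem_sphere_zero_iff_norm.1 hζ) heq]
              have := (abs_le.1 (hC ζ hζ)).2
              linarith) hw'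
          rw [← hq] at h1
          linarith
      · rw [hsph w (mem_sphere_zero_iff_norm.2 hweq), ← norm_sub_sq_of_mem_sphere hweq heq]
        exact hC w (mem_sphere_zero_iff_norm.2 hweq)
    have hcont : Continuous fun w : ℂ => ε / 2 + C * (2 - 2 * (conj z * w).re) := by fun_prop
    have hz1 : ε / 2 + C * (2 - 2 * (conj z * z).re) < ε := by
      rw [← norm_sub_sq_of_mem_sphere heq heq]
      simp [hε]
    have hev := (hcont.tendsto z).eventually (gt_mem_nhds hz1)
    filter_upwards [mem_nhdsWithin_of_mem_nhds hev, self_mem_nhdsWithin] with w hw1 hw2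
    rw [hsph z hzs, Real.dist_eq]
    exact (key w hw2).trans_lt hw1

/-! ### Geometry of the regular polygon: edges, half-planes, sectors. -/

/-- The unit complex number of argument `a`. -/
def rot (a : ℝ) : ℂ := Complex.exp (a * Complex.I)

theorem rot_add (a b : ℝ) : rot (a + b) = rot a * rot b := by
  rw [rot, rot, rot, ← Complex.exp_add]
  push_cast
  ring_nf

@[simp] theorem rot_zero : rot 0 = 1 := by simp [rot]

@[simp] theorem rot_re (a : ℝ) : (rot a).re = Real.cos a := Complex.exp_ofReal_mul_I_re a

@[simp] theorem rot_im (a : ℝ) : (rot a).im = Real.sin a := Complex.exp_ofReal_mul_I_im a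

@[simp] theorem norm_rot (a : ℝ) : ‖rot a‖ = 1 := Complex.norm_exp_ofReal_mul_I a

@[simp] theorem conj_rot (a : ℝ) : conj (rot a) = rot (-a) := by
  apply Complex.ext <;> simp

theorem rot_mul_rot (a b : ℝ) : rot a * rot b = rot (a + b) := (rot_add a b).symm

theorem rot_int_mul_two_pi (n : ℤ) : rot (n * (2 * Real.pi)) = 1 := by
  have h := Real.sin_int_mul_pi (n * 2)
  push_cast at h
  rw [mul_assoc] at h
  apply Complex.ext <;> simp [h]

theorem norm_mul_rot_arg (z : ℂ) : (‖z‖ : ℂ) * rot z.arg = z := Complex.norm_mul_exp_arg_mul_I z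

/-- Half of the angle under which an edge of the regular polygon is seen from its centre. -/
def halfAngle (K : ℕ) : ℝ := Real.pi / K

section

variable {K : ℕ}

theorem mul_halfAngle (hK : 3 ≤ K) : K * halfAngle K = Real.pi := by
  have : (K : ℝ) ≠ 0 := by positivity
  rw [halfAngle]
  field_simp

theorem halfAngle_pos (hK : 3 ≤ K) : 0 < halfAngle K := by
  have := Real.pi_pos
  rw [halfAngle]
  positivity

theorem halfAngle_le (hK : 3 ≤ K) : halfAngle K ≤ Real.pi / 3 := by
  have : (3 : ℝ) ≤ K := by exact_mod_cast hK
  have := Real.pi_pos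
  rw [halfAngle]
  gcongr

theorem sin_halfAngle_pos (hK : 3 ≤ K) : 0 < Real.sin (halfAngle K) :=
  Real.sin_pos_of_pos_of_lt_pi (halfAngle_pos hK) (by linarith [halfAngle_le hK, Real.pi_pos])

theorem cos_halfAngle_pos (hK : 3 ≤ K) : 0 < Real.cos (halfAngle K) :=
  Real.cos_pos_of_mem_Ioo ⟨by linarith [halfAngle_pos hK, Real.pi_pos],
    by linarith [halfAngle_le hK, Real.pi_pos]⟩

theorem vertex_eq_rot (K : ℕ) (k : ℤ) : vertex K k = rot (2 * k * halfAngle K) := by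
  apply Complex.ext <;> simp [vertex, halfAngle] <;> congr 1 <;> ring

@[simp] theorem norm_vertex (K : ℕ) (k : ℤ) : ‖vertex K k‖ = 1 := by
  rw [vertex_eq_rot, norm_rot]

/-- The rotation that takes the outward normal of the edge `k` to the positive real axis. -/
def edgeFrame (K : ℕ) (k : ℤ) (z : ℂ) : ℂ := z * rot (-((2 * k + 1) * halfAngle K))

theorem edgeFrame_mul_rot (K : ℕ) (k : ℤ) (z : ℂ) :
    edgeFrame K k z * rot ((2 * k + 1) * halfAngle K) = z := by
  rw [edgeFrame, mul_assoc, rot_mul_rot, neg_add_cancel, rot_zero, mul_one]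

theorem edgeFrame_vertex (K : ℕ) (k l : ℤ) :
    edgeFrame K l (vertex K k) = rot ((2 * (k - l : ℤ) - 1 : ℤ) * halfAngle K) := by
  rw [edgeFrame, vertex_eq_rot, rot_mul_rot]
  push_cast
  congr 1
  ring

theorem continuous_edgeFrame (K : ℕ) (k : ℤ) : Continuous (edgeFrame K k) := by
  unfold edgeFrame
  fun_prop

theorem edgeFrame_add (K : ℕ) (k : ℤ) (z w : ℂ) :
    edgeFrame K k (z + w) = edgeFrame K k z + edgeFrame K k w := add_mul _ _ _

theorem edgeFrame_smul (K : ℕ) (k : ℤ) (t : ℝ) (z : ℂ) :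
    edgeFrame K k (t • z) = t • edgeFrame K k z := smul_mul_assoc _ _ _

theorem edgeFrame_injective (K : ℕ) (k : ℤ) : Function.Injective (edgeFrame K k) := fun z w h => by
  rw [← edgeFrame_mul_rot K k z, h, edgeFrame_mul_rot]

theorem cos_odd_mul_halfAngle_le (hK : 3 ≤ K) (m : ℤ) :
    Real.cos ((2 * m - 1 : ℤ) * halfAngle K) ≤ Real.cos (halfAngle K) := by
  have hp := halfAngle_pos hK
  have hKp := mul_halfAngle hK
  set p := halfAngle K
  -- Removing the nearest multiple of `2π = 2Kp` leaves an angle in `[-π, π]` that is still an odd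
  -- multiple of `p`, so its absolute value is at least `p`, and cosine decreases on `[0, π]`.
  let n : ℤ := round (((2 * m - 1 : ℤ) * p) / (2 * Real.pi))
  have hn := abs_sub_round (((2 * m - 1 : ℤ) * p) / (2 * Real.pi))
  have hpi := Real.pi_pos
  have hx : |(2 * m - 1 : ℤ) * p - n * (2 * Real.pi)| ≤ Real.pi := by
    have h1 : (2 * m - 1 : ℤ) * p - n * (2 * Real.pi) =
        (((2 * m - 1 : ℤ) * p) / (2 * Real.pi) - n) * (2 * Real.pi) := by field_simp
    rw [h1, abs_mul, abs_of_pos (by positivity : 0 < 2 * Real.pi)]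
    nlinarith
  have hodd : (1 : ℝ) ≤ |((2 * (m - n * K) - 1 : ℤ) : ℝ)| := by
    rw [← Int.cast_abs]
    exact_mod_cast Int.one_le_abs (by omega)
  have hx2 : (2 * m - 1 : ℤ) * p - n * (2 * Real.pi) = (2 * (m - n * K) - 1 : ℤ) * p := by
    rw [← hKp]
    push_cast
    ring
  rw [← Real.cos_sub_int_mul_two_pi _ n, ← Real.cos_abs]
  refine Real.cos_le_cos_of_nonneg_of_le_pi hp.le hx ?_
  rw [hx2, abs_mul, abs_of_pos hp]
  nlinarith

theorem edgeFrame_re_le (hK : 3 ≤ K) {z : ℂ} (hz : z ∈ closedPolygon K) (l : ℤ) :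
    (edgeFrame K l z).re ≤ Real.cos (halfAngle K) := by
  have hconv : Convex ℝ {z | (edgeFrame K l z).re ≤ Real.cos (halfAngle K)} := by
    intro z hz w hw a b ha hb hab
    rw [mem_ofPred_eq] at *
    rw [edgeFrame_add, edgeFrame_smul, edgeFrame_smul, Complex.add_re, Complex.smul_re,
      Complex.smul_re, smul_eq_mul, smul_eq_mul]
    calc _ ≤ a * Real.cos (halfAngle K) + b * Real.cos (halfAngle K) := by gcongr
      _ = _ := by rw [← add_mul, hab, one_mul]
  refine convexHull_min ?_ hconv hz
  rintro _ ⟨k, rfl⟩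
  rw [mem_ofPred_eq, edgeFrame_vertex, rot_re]
  exact cos_odd_mul_halfAngle_le hK _

theorem mem_edge_iff (hK : 3 ≤ K) {z : ℂ} {k : ℤ} : z ∈ edge K k ↔
    (edgeFrame K k z).re = Real.cos (halfAngle K) ∧
      |(edgeFrame K k z).im| ≤ Real.sin (halfAngle K) := by
  have hs := sin_halfAngle_pos hK
  have e0 : edgeFrame K k (vertex K k) = rot (-halfAngle K) := by
    rw [edgeFrame_vertex]; congr 1; push_cast; ring
  have e1 : edgeFrame K k (vertex K (k + 1)) = rot (halfAngle K) := by
    rw [edgeFrame_vertex]; congr 1; push_cast; ring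
  constructor
  · rintro ⟨a, b, ha, hb, hab, rfl⟩
    rw [edgeFrame_add, edgeFrame_smul, edgeFrame_smul, e0, e1]
    simp only [Complex.add_re, Complex.smul_re, rot_re, Real.cos_neg, smul_eq_mul, Complex.add_im,
      Complex.smul_im, rot_im, Real.sin_neg]
    refine ⟨by rw [← add_mul, hab, one_mul], ?_⟩
    rw [abs_le]
    constructor <;> nlinarith
  · rintro ⟨h1, h2⟩
    rw [abs_le] at h2
    set y := (edgeFrame K k z).im
    set σ := Real.sin (halfAngle K)
    refine ⟨(1 - y / σ) / 2, (1 + y / σ) / 2, ?_, ?_, by ring, ?_⟩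
    · have : y / σ ≤ 1 := by rw [div_le_one hs]; linarith
      linarith
    · have : -1 ≤ y / σ := by rw [le_div_iff₀ hs]; linarith
      linarith
    · apply edgeFrame_injective K k
      rw [edgeFrame_add, edgeFrame_smul, edgeFrame_smul, e0, e1]
      apply Complex.ext
      · simp [h1]; ring
      · simp
        change _ = y
        field_simp
        ring

theorem vertex_mem_edge (K : ℕ) (k : ℤ) : vertex K k ∈ edge K k := left_mem_segment ..

theorem vertex_mem_closedPolygon (K : ℕ) (k : ℤ) : vertex K k ∈ closedPolygon K :=
  subset_convexHull ℝ _ ⟨k, rfl⟩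

theorem convex_closedPolygon (K : ℕ) : Convex ℝ (closedPolygon K) := convex_convexHull ℝ _

theorem edge_subset_closedPolygon (K : ℕ) (k : ℤ) : edge K k ⊆ closedPolygon K :=
  (convex_closedPolygon K).segment_subset (vertex_mem_closedPolygon K k)
    (vertex_mem_closedPolygon K (k + 1))

theorem zero_mem_closedPolygon (hK : 3 ≤ K) : (0 : ℂ) ∈ closedPolygon K := by
  have hp := halfAngle_pos hK
  have h1 : rot (2 * halfAngle K) ≠ 1 := fun h => by
    have h2 := congrArg Complex.im h
    rw [rot_im, Complex.one_im] at h2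
    exact (Real.sin_pos_of_pos_of_lt_pi (x := 2 * halfAngle K) (by linarith)
      (by linarith [halfAngle_le hK, Real.pi_pos])).ne' h2
  have hpow : ∀ n : ℕ, rot (2 * halfAngle K) ^ n = vertex K n := fun n => by
    rw [vertex_eq_rot, rot, rot, ← Complex.exp_nat_mul]
    congr 1
    push_cast
    ring
  -- The vertices are the `K`-th roots of unity, so the centre is their average.
  have hsum : ∑ n ∈ Finset.range K, vertex K n = 0 := by
    simp_rw [← hpow]
    have h2 := geom_sum_mul (rot (2 * halfAngle K)) K
    have h3 : rot (2 * halfAngle K) ^ K = 1 := by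
      rw [hpow, vertex_eq_rot, Int.cast_natCast, mul_assoc, mul_halfAngle hK]
      simpa using rot_int_mul_two_pi 1
    rw [h3, sub_self] at h2
    exact (mul_eq_zero.1 h2).resolve_right (sub_ne_zero.2 h1)
  have hK0 : (K : ℝ) ≠ 0 := by positivity
  have := (convex_closedPolygon K).sum_mem (t := Finset.range K) (w := fun _ => (1 / K : ℝ))
    (z := fun n => vertex K n) (fun _ _ => by positivity) (by simp [hK0])
    (fun n _ => vertex_mem_closedPolygon K n)
  rwa [← Finset.smul_sum, hsum, smul_zero] at this

/-- The closed sector of half-width `halfAngle K` around the direction `j * halfAngle K`. -/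
def sector (K : ℕ) (j : ℤ) : Set ℂ :=
  {z | |(z * rot (-(j * halfAngle K))).im| * Real.cos (halfAngle K) ≤
    (z * rot (-(j * halfAngle K))).re * Real.sin (halfAngle K)}

theorem mem_sector_odd {z : ℂ} {k : ℤ} : z ∈ sector K (2 * k + 1) ↔
    |(edgeFrame K k z).im| * Real.cos (halfAngle K) ≤
      (edgeFrame K k z).re * Real.sin (halfAngle K) := by
  rw [sector, edgeFrame, mem_ofPred_eq]
  push_cast
  rfl

theorem isClosed_sector (K : ℕ) (j : ℤ) : IsClosed (sector K j) :=
  isClosed_le (by fun_prop) (by fun_prop)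

theorem exists_mem_sector_odd (hK : 3 ≤ K) (z : ℂ) : ∃ k : ℤ, z ∈ sector K (2 * k + 1) := by
  have hp := halfAngle_pos hK
  have hp3 := halfAngle_le hK
  let k : ℤ := ⌊z.arg / (2 * halfAngle K)⌋
  have h1 : k * (2 * halfAngle K) ≤ z.arg := by
    rw [← le_div_iff₀ (by positivity)]; exact Int.floor_le _
  have h2 : z.arg < (k + 1) * (2 * halfAngle K) := by
    rw [← div_lt_iff₀ (by positivity)]; exact Int.lt_floor_add_one _
  refine ⟨k, mem_sector_odd.2 ?_⟩
  have hfr : edgeFrame K k z = ‖z‖ * rot (z.arg - (2 * k + 1) * halfAngle K) := by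
    rw [edgeFrame, sub_eq_add_neg, rot_add, ← mul_assoc, norm_mul_rot_arg]
  set ψ := z.arg - (2 * k + 1) * halfAngle K with hψ
  have h3 : 0 ≤ Real.sin (halfAngle K - ψ) :=
    Real.sin_nonneg_of_nonneg_of_le_pi (by linarith) (by linarith)
  have h4 : 0 ≤ Real.sin (halfAngle K + ψ) :=
    Real.sin_nonneg_of_nonneg_of_le_pi (by linarith) (by linarith)
  rw [Real.sin_sub] at h3
  rw [Real.sin_add] at h4
  rw [hfr, Complex.im_ofReal_mul, Complex.re_ofReal_mul, rot_im, rot_re, abs_mul, abs_norm,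
    mul_assoc, mul_assoc]
  refine mul_le_mul_of_nonneg_left ?_ (norm_nonneg z)
  rcases abs_cases (Real.sin ψ) with ⟨h, _⟩ | ⟨h, _⟩ <;> rw [h] <;> linarith

/-- The ray through vertex `k` cuts the even sector into two halves, each lying in the half of an
edge sector adjacent to that vertex. There the interpolation at the far end of the edge is inactive.
-/
theorem mem_sector_odd_of_even (hK : 3 ≤ K) {z : ℂ} {k : ℤ} (hz : z ∈ sector K (2 * k)) :
    z ∈ sector K (2 * (k - 1) + 1) ∧ (edgeFrame K (k - 1) z).im ≥ 0 ∨
    z ∈ sector K (2 * k + 1) ∧ (edgeFrame K k z).im ≤ 0 := by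
  have hs := sin_halfAngle_pos hK
  have hc := cos_halfAngle_pos hK
  rw [mem_sector_odd, mem_sector_odd]
  rw [sector, mem_ofPred_eq] at hz
  set u := z * rot (-((2 * k : ℤ) * halfAngle K)) with hu
  have h1 : edgeFrame K k z = u * rot (-halfAngle K) := by
    rw [hu, edgeFrame, mul_assoc, rot_mul_rot]; congr 2; push_cast; ring
  have h2 : edgeFrame K (k - 1) z = u * rot (halfAngle K) := by
    rw [hu, edgeFrame, mul_assoc, rot_mul_rot]; congr 2; push_cast; ring
  rw [h1, h2]
  simp only [Complex.mul_re, Complex.mul_im, rot_re, rot_im, Real.cos_neg, Real.sin_neg]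
  set c := Real.cos (halfAngle K)
  set σ := Real.sin (halfAngle K)
  rcases le_total 0 u.im with h | h
  · rw [abs_of_nonneg h] at hz
    right
    have h3 : u.re * -σ + u.im * c ≤ 0 := by linarith
    rw [abs_of_nonpos h3]
    refine ⟨?_, h3⟩
    nlinarith [mul_nonneg h (mul_nonneg hc.le hc.le), mul_nonneg h (mul_nonneg hs.le hs.le)]
  · rw [abs_of_nonpos h] at hz
    left
    have h3 : 0 ≤ u.re * σ + u.im * c := by linarith
    rw [abs_of_nonneg h3]
    refine ⟨?_, h3⟩
    nlinarith [mul_nonneg (neg_nonneg.2 h) (mul_nonneg hc.le hc.le),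
      mul_nonneg (neg_nonneg.2 h) (mul_nonneg hs.le hs.le)]

/-- The radial projection of a nonzero `z` hits edge `k`, and the polygon is star-shaped about its
centre. This makes the polygon the intersection of its supporting half-planes. -/
theorem mem_closedPolygon_of_mem_sector (hK : 3 ≤ K) {z : ℂ} {k : ℤ}
    (hz : z ∈ sector K (2 * k + 1)) (hre : (edgeFrame K k z).re ≤ Real.cos (halfAngle K)) :
    z ∈ closedPolygon K := by
  have hs := sin_halfAngle_pos hK
  have hc := cos_halfAngle_pos hK
  rw [mem_sector_odd] at hz
  set x := (edgeFrame K k z).re with hx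
  set c := Real.cos (halfAngle K) with hcdef
  have hx0 : 0 ≤ x := by
    have : 0 ≤ |(edgeFrame K k z).im| * c := by positivity
    exact nonneg_of_mul_nonneg_left (this.trans hz) hs
  rcases hx0.eq_or_lt with h0 | hpos
  · rw [← h0, zero_mul] at hz
    have him : (edgeFrame K k z).im = 0 := by
      rw [← abs_eq_zero]
      exact le_antisymm (nonpos_of_mul_nonpos_left hz hc) (abs_nonneg _)
    have : edgeFrame K k z = 0 := Complex.ext h0.symm him
    have hz0 : z = 0 := by rw [← edgeFrame_mul_rot K k z, this, zero_mul]
    rw [hz0]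
    exact zero_mem_closedPolygon hK
  · have hmem : (c / x) • z ∈ closedPolygon K := by
      apply edge_subset_closedPolygon K k
      rw [mem_edge_iff hK, edgeFrame_smul, Complex.smul_re, Complex.smul_im, smul_eq_mul,
        smul_eq_mul, ← hx, abs_mul, abs_of_pos (div_pos hc hpos)]
      refine ⟨by field_simp; rfl, ?_⟩
      rw [div_mul_eq_mul_div, div_le_iff₀ hpos]
      linarith
    have := (convex_closedPolygon K).starConvex (zero_mem_closedPolygon hK)
      |>.smul_mem hmem (t := x / c) (by positivity) (by rw [div_le_one hc]; exact hre)
    rwa [smul_smul, show x / c * (c / x) = 1 by field_simp, one_smul] at this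

theorem mem_closedPolygon_iff (hK : 3 ≤ K) {z : ℂ} :
    z ∈ closedPolygon K ↔ ∀ k : ℤ, (edgeFrame K k z).re ≤ Real.cos (halfAngle K) := by
  refine ⟨fun hz k => edgeFrame_re_le hK hz k, fun h => ?_⟩
  obtain ⟨k, hk⟩ := exists_mem_sector_odd hK z
  exact mem_closedPolygon_of_mem_sector hK hk (h k)

theorem isCompact_closedPolygon (hK : 3 ≤ K) : IsCompact (closedPolygon K) := by
  refine (isCompact_closedBall (0 : ℂ) 1).of_isClosed_subset ?_ ?_
  · have : closedPolygon K = ⋂ k : ℤ, {z | (edgeFrame K k z).re ≤ Real.cos (halfAngle K)} := by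
      ext z
      simp [mem_closedPolygon_iff hK]
    rw [this]
    exact isClosed_iInter fun k =>
      isClosed_le (Complex.continuous_re.comp (continuous_edgeFrame K k)) continuous_const
  · refine convexHull_min ?_ (convex_closedBall 0 1)
    rintro _ ⟨k, rfl⟩
    simp

theorem norm_edgeFrame (K : ℕ) (k : ℤ) (z : ℂ) : ‖edgeFrame K k z‖ = ‖z‖ := by
  simp [edgeFrame]

theorem isOpen_polygon (K : ℕ) : IsOpen (polygon K) := isOpen_interior

theorem polygon_subset (K : ℕ) : polygon K ⊆ closedPolygon K := interior_subset

theorem convex_polygon (K : ℕ) : Convex ℝ (polygon K) := (convex_closedPolygon K).interior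

theorem zero_mem_polygon (hK : 3 ≤ K) : (0 : ℂ) ∈ polygon K := by
  refine mem_interior.2 ⟨ball 0 (Real.cos (halfAngle K)), fun z hz => ?_, isOpen_ball,
    mem_ball_self (cos_halfAngle_pos hK)⟩
  rw [mem_closedPolygon_iff hK]
  intro k
  rw [mem_ball_zero_iff] at hz
  exact ((Complex.re_le_norm _).trans_eq (norm_edgeFrame K k z)).trans hz.le

theorem smul_mem_polygon (hK : 3 ≤ K) {z : ℂ} (hz : z ∈ closedPolygon K) {t : ℝ} (h0 : 0 ≤ t)
    (h1 : t < 1) : t • z ∈ polygon K := by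
  have := (convex_closedPolygon K).combo_interior_self_mem_interior (zero_mem_polygon hK) hz
    (a := 1 - t) (b := t) (by linarith) h0 (by ring)
  rwa [smul_zero, zero_add] at this

theorem edgeFrame_re_lt (hK : 3 ≤ K) {z : ℂ} (hz : z ∈ polygon K) (k : ℤ) :
    (edgeFrame K k z).re < Real.cos (halfAngle K) := by
  have hc : Continuous fun t : ℝ => z + t • rot ((2 * k + 1) * halfAngle K) := by fun_prop
  have hev : ∀ᶠ t : ℝ in 𝓝 0, z + t • rot ((2 * k + 1) * halfAngle K) ∈ polygon K :=
    hc.continuousAt.eventually_mem (by simpa using (isOpen_polygon K).mem_nhds hz)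
  obtain ⟨t, ht, ht0⟩ := ((hev.filter_mono nhdsWithin_le_nhds).and
    (self_mem_nhdsWithin (s := Ioi (0 : ℝ)))).exists
  have h1 := edgeFrame_re_le hK (polygon_subset K ht) k
  have h2 : edgeFrame K k (rot ((2 * k + 1) * halfAngle K)) = 1 := by
    rw [edgeFrame, rot_mul_rot, add_neg_cancel, rot_zero]
  rw [edgeFrame_add, edgeFrame_smul, h2] at h1
  simp at h1
  have : 0 < t := ht0
  linarith

theorem notMem_polygon_of_mem_edge (hK : 3 ≤ K) {z : ℂ} {k : ℤ} (hz : z ∈ edge K k) :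
    z ∉ polygon K := fun h => (edgeFrame_re_lt hK h k).ne ((mem_edge_iff hK).1 hz).1

theorem mem_edge_of_mem_sector (hK : 3 ≤ K) {z : ℂ} {k : ℤ} (hz : z ∈ closedPolygon K)
    (hzs : z ∈ sector K (2 * k + 1)) (hn : z ∉ polygon K) : z ∈ edge K k := by
  have hs := sin_halfAngle_pos hK
  have hc := cos_halfAngle_pos hK
  have hle := edgeFrame_re_le hK hz k
  rw [mem_sector_odd] at hzs
  rcases hle.lt_or_eq with hlt | heq
  · exfalso
    apply hn
    set x := (edgeFrame K k z).re with hx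
    set c := Real.cos (halfAngle K) with hcdef
    have hx0 : 0 ≤ x := by
      have : 0 ≤ |(edgeFrame K k z).im| * c := by positivity
      exact nonneg_of_mul_nonneg_left (this.trans hzs) hs
    -- The midpoint of `x / c` and `1`: then `t < 1`, while `t⁻¹ • z` still satisfies the half-plane
    -- inequality of edge `k`, so `z` is a strict contraction of a point of the polygon.
    let t : ℝ := (x + c) / (2 * c)
    have ht : 0 < t := by positivity
    have ht1 : t < 1 := by rw [div_lt_one (by positivity)]; linarith
    have hmem : t⁻¹ • z ∈ closedPolygon K := by
      apply mem_closedPolygon_of_mem_sector hK (k := k)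
      · rw [mem_sector_odd, edgeFrame_smul, Complex.smul_re, Complex.smul_im, smul_eq_mul,
          smul_eq_mul, abs_mul, abs_of_pos (inv_pos.2 ht), mul_assoc, mul_assoc]
        exact mul_le_mul_of_nonneg_left hzs (inv_pos.2 ht).le
      · rw [edgeFrame_smul, Complex.smul_re, smul_eq_mul, ← hx, inv_mul_le_iff₀ ht]
        have : t * c = (x + c) / 2 := by simp only [t]; field_simp
        rw [this]
        linarith
    have := smul_mem_polygon hK hmem ht.le ht1
    rwa [smul_smul, mul_inv_cancel₀ ht.ne', one_smul] at this
  · rw [mem_edge_iff hK]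
    refine ⟨heq, ?_⟩
    rw [heq, mul_comm] at hzs
    exact le_of_mul_le_mul_left hzs hc

theorem exists_mem_edge (hK : 3 ≤ K) {z : ℂ} (hz : z ∈ closedPolygon K) (hn : z ∉ polygon K) :
    ∃ k, z ∈ edge K k := by
  obtain ⟨k, hk⟩ := exists_mem_sector_odd hK z
  exact ⟨k, mem_edge_of_mem_sector hK hz hk hn⟩

theorem vertex_add_mul (hK : 3 ≤ K) (k n : ℤ) : vertex K (k + n * K) = vertex K k := by
  have h : (2 * (k + n * K : ℤ) * halfAngle K : ℝ) = 2 * k * halfAngle K + n * (2 * Real.pi) := by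
    rw [← mul_halfAngle hK]
    push_cast
    ring
  rw [vertex_eq_rot, vertex_eq_rot, h, rot_add, rot_int_mul_two_pi, mul_one]

theorem edge_add_mul (hK : 3 ≤ K) (k n : ℤ) : edge K (k + n * K) = edge K k := by
  rw [edge, edge, add_right_comm, vertex_add_mul hK, vertex_add_mul hK]

theorem cos_odd_mul_halfAngle_eq (hK : 3 ≤ K) {m : ℤ}
    (h : Real.cos ((2 * m - 1 : ℤ) * halfAngle K) = Real.cos (halfAngle K)) :
    ∃ n : ℤ, m = n * K ∨ m = n * K + 1 := by
  have hp := halfAngle_pos hK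
  rw [Real.cos_eq_cos_iff] at h
  obtain ⟨n, h | h⟩ := h
  · refine ⟨-n, Or.inr ?_⟩
    rw [← mul_halfAngle hK] at h
    have h1 : ((2 * m - 1 : ℤ) + 2 * n * K - 1 : ℝ) * halfAngle K = 0 := by linarith
    have h2 := (mul_eq_zero.1 h1).resolve_right hp.ne'
    have h3 : 2 * m - 1 + 2 * n * K - 1 = 0 := by exact_mod_cast h2
    linarith
  · refine ⟨n, Or.inl ?_⟩
    rw [← mul_halfAngle hK] at h
    have h1 : ((2 * m - 1 : ℤ) - 2 * n * K + 1 : ℝ) * halfAngle K = 0 := by linarith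
    have h2 := (mul_eq_zero.1 h1).resolve_right hp.ne'
    have h3 : 2 * m - 1 - 2 * n * K + 1 = 0 := by exact_mod_cast h2
    linarith

theorem le_left_of_combo_eq {a b x y c : ℝ} (ha : 0 < a) (hb : 0 ≤ b) (hab : a + b = 1)
    (hy : y ≤ c) (h : a * x + b * y = c) : c ≤ x := by
  have h1 : a * (x - c) = b * (c - y) := by
    have : (a + b) * c = c := by rw [hab, one_mul]
    linarith
  have h2 : 0 ≤ a * (x - c) := h1 ▸ mul_nonneg hb (sub_nonneg.2 hy)
  linarith [nonneg_of_mul_nonneg_right h2 ha]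

/-- Two edges of the regular polygon that meet are equal or have a vertex in common. -/
theorem eq_or_eq_of_mem_edge (hK : 3 ≤ K) {z : ℂ} {k l : ℤ} (hk : z ∈ edge K k)
    (hl : z ∈ edge K l) : (∃ n : ℤ, k = l + n * K) ∨ (z = vertex K k ∧ ∃ n : ℤ, k = l + 1 + n * K) ∨
      (z = vertex K (k + 1) ∧ ∃ n : ℤ, k + 1 = l + n * K) := by
  have hre := ((mem_edge_iff hK).1 hl).1
  obtain ⟨a, b, ha, hb, hab, rfl⟩ := hk
  rw [edgeFrame_add, edgeFrame_smul, edgeFrame_smul, edgeFrame_vertex, edgeFrame_vertex,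
    Complex.add_re, Complex.smul_re, Complex.smul_re, rot_re, rot_re, smul_eq_mul,
    smul_eq_mul] at hre
  have h1 := cos_odd_mul_halfAngle_le hK (k - l)
  have h2 := cos_odd_mul_halfAngle_le hK (k + 1 - l)
  -- The point attains the maximum of a linear functional over the polygon, so each vertex that
  -- carries positive weight attains it too and must be an end point of edge `l`.
  have e1 : 0 < a → ∃ n : ℤ, k - l = n * K ∨ k - l = n * K + 1 := fun h =>
    cos_odd_mul_halfAngle_eq hK (le_antisymm h1 (le_left_of_combo_eq h hb hab h2 hre))
  have e2 : 0 < b → ∃ n : ℤ, k + 1 - l = n * K ∨ k + 1 - l = n * K + 1 := fun h =>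
    cos_odd_mul_halfAngle_eq hK (le_antisymm h2 (le_left_of_combo_eq h ha
      (add_comm a b ▸ hab) h1 ((add_comm _ _).trans hre)))
  rcases ha.eq_or_lt with ha0 | ha0
  · have hb1 : b = 1 := by linarith
    obtain ⟨n, h | h⟩ := e2 (by linarith)
    · exact Or.inr (Or.inr ⟨by simp [← ha0, hb1], n, by linarith⟩)
    · exact Or.inl ⟨n, by linarith⟩
  rcases hb.eq_or_lt with hb0 | hb0
  · have ha1 : a = 1 := by linarith
    obtain ⟨n, h | h⟩ := e1 ha0
    · exact Or.inl ⟨n, by linarith⟩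
    · exact Or.inr (Or.inl ⟨by simp [← hb0, ha1], n, by linarith⟩)
  obtain ⟨n, h | h⟩ := e1 ha0
  · exact Or.inl ⟨n, by linarith⟩
  obtain ⟨m, h' | h'⟩ := e2 hb0
  · exfalso
    have h3 : (m - n) * (K : ℤ) = 2 := by linarith
    have h4 := Int.le_of_dvd two_pos (Dvd.intro_left _ h3)
    omega
  · exact Or.inl ⟨m, by linarith⟩

end

/-! ### The Schwarz-Christoffel map and its injectivity. -/

/-- The derivative `(1 - z ^ K) ^ (-2 / K)` of the Schwarz-Christoffel map of the regular
polygon. -/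
def scDeriv (K : ℕ) (z : ℂ) : ℂ := (1 - z ^ K) ^ ((-(2 / K) : ℝ) : ℂ)

/-- The Schwarz-Christoffel map of the unit disc onto a regular polygon with `K` edges. -/
def scMap (K : ℕ) (z : ℂ) : ℂ := z * ∫ t in (0 : ℝ)..1, scDeriv K (t * z)

section

variable {K : ℕ}

theorem re_one_sub_pow_pos_of_norm_lt_one (hK : 3 ≤ K) {z : ℂ} (hz : ‖z‖ < 1) :
    0 < (1 - z ^ K).re := by
  have h1 : ‖z ^ K‖ < 1 := by
    rw [norm_pow]
    exact pow_lt_one₀ (norm_nonneg z) hz (by omega)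
  rw [Complex.sub_re, Complex.one_re]
  linarith [Complex.re_le_norm (z ^ K)]

/-- The argument of the base is below `π / 2` in absolute value, and the exponent `-2 / K` does not
enlarge it. This positivity is what makes the map injective. -/
theorem scDeriv_re_pos (hK : 3 ≤ K) {z : ℂ} (hz : 0 < (1 - z ^ K).re) : 0 < (scDeriv K z).re := by
  have hne : 1 - z ^ K ≠ 0 := fun h => by rw [h] at hz; exact lt_irrefl _ hz
  have hKr : (3 : ℝ) ≤ K := by exact_mod_cast hK
  rw [scDeriv, Complex.cpow_def_of_ne_zero hne, Complex.exp_re]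
  refine mul_pos (Real.exp_pos _) (Real.cos_pos_of_mem_Ioo ?_)
  rw [Complex.im_mul_ofReal, Complex.log_im]
  have harg := (Complex.abs_arg_lt_pi_div_two_iff.2 (Or.inl hz))
  have h2 : |(1 - z ^ K).arg * -(2 / K)| < Real.pi / 2 := by
    rw [abs_mul, abs_neg, abs_of_pos (by positivity : (0 : ℝ) < 2 / K)]
    refine lt_of_le_of_lt (mul_le_of_le_one_right (abs_nonneg _) ?_) harg
    rw [div_le_one (by positivity)]
    linarith
  exact ⟨by linarith [(abs_lt.1 h2).1], (abs_lt.1 h2).2⟩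

theorem differentiableAt_scDeriv {z : ℂ} (hz : 0 < (1 - z ^ K).re) :
    DifferentiableAt ℂ (scDeriv K) z := by
  unfold scDeriv
  exact DifferentiableAt.cpow (by fun_prop) (by fun_prop) (Or.inl hz)

theorem norm_scDeriv_le (hK : 3 ≤ K) {z : ℂ} (hz : ‖z‖ ≤ 1) {t : ℝ} (ht0 : 0 ≤ t) (ht1 : t < 1) :
    ‖scDeriv K (t * z)‖ ≤ (1 - t) ^ (-(2 / K) : ℝ) := by
  rw [scDeriv, Complex.norm_cpow_real]
  refine Real.rpow_le_rpow_of_nonpos (by linarith) ?_ ?_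
  · have h1 : ‖((t : ℂ) * z) ^ K‖ ≤ t := by
      rw [norm_pow, norm_mul, Complex.norm_of_nonneg ht0]
      calc (t * ‖z‖) ^ K ≤ t ^ K := by
            gcongr
            exact mul_le_of_le_one_right ht0 hz
        _ ≤ t := pow_le_of_le_one ht0 ht1.le (by omega)
    have h2 := norm_sub_norm_le 1 (((t : ℂ) * z) ^ K)
    rw [norm_one] at h2
    linarith
  · rw [neg_nonpos]
    positivity

theorem norm_ofReal_mul_lt_one {z : ℂ} (hz : ‖z‖ ≤ 1) {t : ℝ} (ht0 : 0 ≤ t) (ht1 : t < 1) :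
    ‖(t : ℂ) * z‖ < 1 := by
  rw [norm_mul, Complex.norm_of_nonneg ht0]
  exact (mul_le_of_le_one_right ht0 hz).trans_lt ht1

/-- Dominated convergence up to the boundary, prevertices included: the majorant `(1 - t) ^ (-2 /
K)` does not depend on `z` and is integrable because `2 / K < 1`. The possible singularity at `t =
1` is a null set. -/
theorem continuousOn_scMap (hK : 3 ≤ K) : ContinuousOn (scMap K) (closedBall 0 1) := by
  have hKr : (3 : ℝ) ≤ K := by exact_mod_cast hK
  refine continuousOn_id.mul fun z hz => ?_
  have hae : ∀ᵐ t : ℝ, t ∉ ({1} : Set ℝ) := (countable_singleton (1 : ℝ)).ae_notMem _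
  refine intervalIntegral.continuousWithinAt_of_dominated_interval
    (bound := fun t => (1 - t) ^ (-(2 / K) : ℝ)) ?_ ?_ ?_ ?_
  · refine Eventually.of_forall fun w => ?_
    unfold scDeriv
    exact (Measurable.pow_const (by fun_prop) _).aestronglyMeasurable
  · filter_upwards [self_mem_nhdsWithin] with w hw
    filter_upwards [hae] with t ht1 ht
    rw [uIoc_of_le zero_le_one] at ht
    exact norm_scDeriv_le hK (mem_closedBall_zero_iff.1 hw) ht.1.le (ht.2.lt_of_ne ht1)
  · have h1 : IntervalIntegrable (fun t : ℝ => t ^ (-(2 / K) : ℝ)) MeasureTheory.volume 1 0 := by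
      apply intervalIntegral.intervalIntegrable_rpow'
      rw [neg_lt_neg_iff, div_lt_one (by positivity)]
      linarith
    simpa using h1.comp_sub_left 1
  · filter_upwards [hae] with t ht1 ht
    rw [uIoc_of_le zero_le_one] at ht
    have hpos := re_one_sub_pow_pos_of_norm_lt_one hK
      (norm_ofReal_mul_lt_one (mem_closedBall_zero_iff.1 hz) ht.1.le (ht.2.lt_of_ne ht1))
    exact ((differentiableAt_scDeriv hpos).continuousAt.comp
      (f := fun x : ℂ => (t : ℂ) * x) (by fun_prop)).continuousWithinAt

theorem differentiableAt_scDeriv_of_mem_ball (hK : 3 ≤ K) {z : ℂ} (hz : z ∈ ball (0 : ℂ) 1) :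
    DifferentiableAt ℂ (scDeriv K) z :=
  differentiableAt_scDeriv (re_one_sub_pow_pos_of_norm_lt_one hK (mem_ball_zero_iff.1 hz))

theorem hasDerivAt_scMap (hK : 3 ≤ K) {z : ℂ} (hz : z ∈ ball (0 : ℂ) 1) :
    HasDerivAt (scMap K) (scDeriv K z) z := by
  have hd : DifferentiableOn ℂ (scDeriv K) (ball 0 1) := fun w hw =>
    (differentiableAt_scDeriv_of_mem_ball hK hw).differentiableWithinAt
  obtain ⟨F, hF0, hF⟩ := hd.isExactOn_ball.with_val_at 0 0
  have heq : ∀ w ∈ ball (0 : ℂ) 1, scMap K w = F w := by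
    intro w hw
    have hseg : ∀ t ∈ uIcc (0 : ℝ) 1, (t : ℂ) * w ∈ ball (0 : ℂ) 1 := by
      intro t ht
      rw [uIcc_of_le zero_le_one] at ht
      rw [mem_ball_zero_iff] at hw ⊢
      rw [norm_mul, Complex.norm_of_nonneg ht.1]
      exact (mul_le_of_le_one_left (norm_nonneg w) ht.2).trans_lt hw
    have h1 : ∀ t ∈ uIcc (0 : ℝ) 1,
        HasDerivAt (fun t : ℝ => F (t * w)) (w * scDeriv K (t * w)) t := by
      intro t ht
      have h2 : HasDerivAt (fun t : ℝ => (t : ℂ) * w) w t := by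
        simpa using (Complex.ofRealCLM.hasDerivAt (x := t)).mul_const w
      exact (hF _ (hseg t ht)).scomp t h2
    have hcont : ContinuousOn (fun t : ℝ => w * scDeriv K (t * w)) (uIcc 0 1) := by
      refine continuousOn_const.mul fun t ht => ?_
      exact ((differentiableAt_scDeriv_of_mem_ball hK (hseg t ht)).continuousAt.comp
        (f := fun t : ℝ => (t : ℂ) * w) (by fun_prop)).continuousWithinAt
    have h3 := intervalIntegral.integral_eq_sub_of_hasDerivAt h1 hcont.intervalIntegrable
    rw [intervalIntegral.integral_const_mul] at h3
    rw [scMap, h3]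
    simp [hF0]
  refine (hF z hz).congr_of_eventuallyEq ?_
  filter_upwards [isOpen_ball.mem_nhds hz] with w hw using heq w hw

/-- The Noshiro-Warschawski argument: the derivative along the chord, projected on its direction, is
`|b - a|²` times a positive real part. By strict convexity the open chord is inside the open disc,
so `a` and `b` may lie on the circle. -/
theorem re_scMap_sub_mul_conj_pos (hK : 3 ≤ K) {a b : ℂ} (ha : a ∈ closedBall (0 : ℂ) 1)
    (hb : b ∈ closedBall (0 : ℂ) 1) (hab : a ≠ b) :
    0 < ((scMap K b - scMap K a) * conj (b - a)).re := by
  let γ : ℝ → ℂ := fun t => a + t * (b - a)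
  have hγI : ∀ t ∈ Icc (0 : ℝ) 1, γ t ∈ closedBall (0 : ℂ) 1 := fun t ht => by
    have := (convex_closedBall (0 : ℂ) 1).add_smul_sub_mem ha hb ht
    simpa [γ] using this
  have hγo : ∀ t ∈ Ioo (0 : ℝ) 1, γ t ∈ ball (0 : ℂ) 1 := fun t ht => by
    have h1 := strictConvex_closedBall ℝ (0 : ℂ) 1 ha hb hab (a := 1 - t) (b := t)
      (by linarith [ht.2]) ht.1 (by ring)
    rw [interior_closedBall _ one_ne_zero] at h1
    convert h1 using 1
    simp only [γ, Complex.real_smul]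
    push_cast
    ring
  have hcont : ContinuousOn (fun t => (scMap K (γ t) * conj (b - a)).re) (Icc 0 1) := by
    refine Complex.continuous_re.comp_continuousOn (ContinuousOn.mul ?_ continuousOn_const)
    exact (continuousOn_scMap hK).comp (by fun_prop) hγI
  have hder : ∀ t ∈ Ioo (0 : ℝ) 1, HasDerivAt (fun t => (scMap K (γ t) * conj (b - a)).re)
      (((b - a) * scDeriv K (γ t)) * conj (b - a)).re t := by
    intro t ht
    have h2 : HasDerivAt γ (b - a) t := by
      simpa [γ] using ((Complex.ofRealCLM.hasDerivAt (x := t)).mul_const (b - a)).const_add a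
    have h3 := ((hasDerivAt_scMap hK (hγo t ht)).scomp t h2).mul_const (conj (b - a))
    exact Complex.reCLM.hasFDerivAt.comp_hasDerivAt t h3
  have hpos : ∀ t ∈ Ioo (0 : ℝ) 1, 0 < (((b - a) * scDeriv K (γ t)) * conj (b - a)).re := by
    intro t ht
    have h4 : ((b - a) * scDeriv K (γ t)) * conj (b - a) =
        (Complex.normSq (b - a) : ℂ) * scDeriv K (γ t) := by
      rw [← Complex.mul_conj]; ring
    rw [h4, Complex.re_ofReal_mul]
    exact mul_pos (Complex.normSq_pos.2 (sub_ne_zero.2 hab.symm))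
      (scDeriv_re_pos hK (re_one_sub_pow_pos_of_norm_lt_one hK (mem_ball_zero_iff.1 (hγo t ht))))
  have hmono := strictMonoOn_of_deriv_pos (convex_Icc 0 1) hcont fun t ht => by
    rw [interior_Icc] at ht
    rw [(hder t ht).deriv]
    exact hpos t ht
  have := hmono (left_mem_Icc.2 zero_le_one) (right_mem_Icc.2 zero_le_one) zero_lt_one
  simp only [γ, Complex.ofReal_zero, zero_mul, add_zero, Complex.ofReal_one, one_mul,
    add_sub_cancel] at this
  rw [sub_mul, Complex.sub_re]
  linarith

theorem injOn_scMap (hK : 3 ≤ K) : InjOn (scMap K) (closedBall 0 1) := by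
  intro a ha b hb hab
  by_contra hne
  have := re_scMap_sub_mul_conj_pos hK ha hb hne
  rw [hab, sub_self, zero_mul, Complex.zero_re] at this
  exact lt_irrefl _ this

@[simp] theorem scMap_zero (K : ℕ) : scMap K 0 = 0 := by simp [scMap]

theorem scMap_rot_mul (hK : 3 ≤ K) (k : ℤ) (z : ℂ) :
    scMap K (rot (2 * k * halfAngle K) * z) = rot (2 * k * halfAngle K) * scMap K z := by
  have hpow : rot (2 * k * halfAngle K) ^ K = 1 := by
    rw [← rot_int_mul_two_pi k, ← mul_halfAngle hK, rot, rot, ← Complex.exp_nat_mul]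
    congr 1
    push_cast
    ring
  have hd : ∀ w, scDeriv K (rot (2 * k * halfAngle K) * w) = scDeriv K w := fun w => by
    rw [scDeriv, mul_pow, hpow, one_mul, scDeriv]
  simp_rw [scMap, mul_left_comm _ (rot (2 * k * halfAngle K)) z, hd]
  ring

/-- The distance from the centre to the vertices of the image of the Schwarz-Christoffel map. -/
def scRadius (K : ℕ) : ℝ := (scMap K 1).re

theorem scRadius_pos (hK : 3 ≤ K) : 0 < scRadius K := by
  have := re_scMap_sub_mul_conj_pos hK (a := 0) (b := 1) (by simp) (by simp) zero_ne_one
  simpa [scRadius] using this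

theorem scMap_one (K : ℕ) : scMap K 1 = scRadius K := by
  have h : ∀ t ∈ uIcc (0 : ℝ) 1,
      scDeriv K ((t : ℂ) * 1) = (((1 - t ^ K) ^ (-(2 / K) : ℝ) : ℝ) : ℂ) := by
    intro t ht
    rw [uIcc_of_le zero_le_one] at ht
    have h0 : 0 ≤ 1 - t ^ K := sub_nonneg.2 (pow_le_one₀ ht.1 ht.2)
    rw [Complex.ofReal_cpow h0, scDeriv]
    push_cast
    rw [mul_one]
  have h2 : scMap K 1 = ((∫ t in (0 : ℝ)..1, (1 - t ^ K) ^ (-(2 / K) : ℝ) : ℝ) : ℂ) := by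
    rw [scMap, one_mul, intervalIntegral.integral_congr h, intervalIntegral.integral_ofReal]
  rw [scRadius, h2, Complex.ofReal_re]

end

/-! ### Boundary behaviour: arcs of the circle go to straight edges. -/

/-- A function continuous on the closed unit disc with derivative `φ` inside continues
holomorphically across the points of the unit circle near which `φ` does. -/
theorem exists_hasDerivAt_of_continuousOn_closedBall {f φ : ℂ → ℂ}
    (hf : ContinuousOn f (closedBall 0 1)) (hd : ∀ z ∈ ball (0 : ℂ) 1, HasDerivAt f (φ z) z)
    {ζ : ℂ} (hζ : ‖ζ‖ = 1) (hφ : ∀ᶠ z in 𝓝 ζ, DifferentiableAt ℂ φ z) :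
    ∃ G : ℂ → ℂ, HasDerivAt G (φ ζ) ζ ∧ ∀ᶠ z in 𝓝 ζ, ‖z‖ ≤ 1 → f z = G z := by
  obtain ⟨r, hr, hball⟩ := Metric.eventually_nhds_iff_ball.1 hφ
  have hdφ : DifferentiableOn ℂ φ (ball ζ r) := fun z hz => (hball z hz).differentiableWithinAt
  obtain ⟨G₀, hG₀⟩ := hdφ.isExactOn_ball
  have hev : ∀ z : ℂ, ‖z‖ ≤ 1 → z ∈ ball ζ r →
      ∀ᶠ t : ℝ in 𝓝[<] 1, (t : ℂ) * z ∈ ball ζ r ∩ ball (0 : ℂ) 1 := by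
    intro z hz hzr
    have hc : Continuous fun t : ℝ => (t : ℂ) * z := by fun_prop
    have h1 : ∀ᶠ t : ℝ in 𝓝 1, (t : ℂ) * z ∈ ball ζ r :=
      hc.continuousAt.eventually_mem (by simpa using isOpen_ball.mem_nhds hzr)
    have h2 : ∀ᶠ t : ℝ in 𝓝 1, 0 < t := lt_mem_nhds one_pos
    filter_upwards [h1.filter_mono nhdsWithin_le_nhds, h2.filter_mono nhdsWithin_le_nhds,
      self_mem_nhdsWithin] with t ht ht0 ht1
    exact ⟨ht, mem_ball_zero_iff.2 (norm_ofReal_mul_lt_one hz ht0.le ht1)⟩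
  have hζr : ζ ∈ ball ζ r := mem_ball_self hr
  obtain ⟨t₀, ht₀⟩ := (hev ζ hζ.le hζr).exists
  set w₀ : ℂ := (t₀ : ℂ) * ζ
  -- On this convex lens `f` and the local primitive `G₀` of `φ` have the same derivative; radial
  -- limits then extend the identity to the circle.
  have hconst : ∀ w ∈ ball ζ r ∩ ball (0 : ℂ) 1, f w - G₀ w = f w₀ - G₀ w₀ := by
    intro w hw
    have hder : ∀ x ∈ ball ζ r ∩ ball (0 : ℂ) 1, HasDerivAt (fun x => f x - G₀ x) 0 x := by
      intro x hx
      simpa using (hd x hx.2).fun_sub (hG₀ x hx.1)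
    exact (isOpen_ball.inter isOpen_ball).is_const_of_deriv_eq_zero (𝕜 := ℂ)
      ((convex_ball ζ r).inter (convex_ball 0 1)).isPreconnected
      (f := fun x => f x - G₀ x)
      (fun x hx => (hder x hx).differentiableAt.differentiableWithinAt)
      (fun x hx => (hder x hx).deriv) hw ht₀
  refine ⟨fun z => G₀ z + (f w₀ - G₀ w₀), (hG₀ ζ hζr).add_const _, ?_⟩
  filter_upwards [isOpen_ball.mem_nhds hζr] with z hz hz1
  have hmap : Tendsto (fun t : ℝ => (t : ℂ) * z) (𝓝[<] 1) (𝓝[closedBall 0 1] z) := by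
    refine tendsto_nhdsWithin_iff.2 ⟨?_, ?_⟩
    · have hc : Continuous fun t : ℝ => (t : ℂ) * z := by fun_prop
      simpa using (hc.tendsto 1).mono_left nhdsWithin_le_nhds
    · filter_upwards [hev z hz1 hz] with t ht using ball_subset_closedBall ht.2
  have hlim1 : Tendsto (fun t : ℝ => f (t * z)) (𝓝[<] 1) (𝓝 (f z)) :=
    (hf z (mem_closedBall_zero_iff.2 hz1)).tendsto.comp hmap
  have hlim2 : Tendsto (fun t : ℝ => G₀ (t * z) + (f w₀ - G₀ w₀)) (𝓝[<] 1)
      (𝓝 (G₀ z + (f w₀ - G₀ w₀))) :=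
    ((hG₀ z hz).continuousAt.tendsto.comp (hmap.mono_right nhdsWithin_le_nhds)).add_const _
  refine tendsto_nhds_unique (hlim1.congr' ?_) hlim2
  filter_upwards [hev z hz1 hz] with t ht
  rw [← hconst _ ht]
  ring

section

variable {K : ℕ}

theorem one_sub_rot (a : ℝ) : 1 - rot a = (2 * Real.sin (a / 2) : ℝ) * rot ((a - Real.pi) / 2) := by
  have h1 := Real.cos_sq_add_sin_sq (a / 2)
  have h2 : a = 2 * (a / 2) := by ring
  have h3 : (a - Real.pi) / 2 = a / 2 - Real.pi / 2 := by ring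
  apply Complex.ext
  · rw [Complex.sub_re, Complex.one_re, Complex.re_ofReal_mul, rot_re, rot_re, h3,
      Real.cos_sub_pi_div_two]
    nth_rewrite 1 [h2]
    rw [Real.cos_two_mul]
    linarith
  · rw [Complex.sub_im, Complex.one_im, Complex.im_ofReal_mul, rot_im, rot_im, h3,
      Real.sin_sub_pi_div_two]
    nth_rewrite 1 [h2]
    rw [Real.sin_two_mul]
    ring

theorem rot_pow (a : ℝ) (n : ℕ) : rot a ^ n = rot (n * a) := by
  rw [rot, rot, ← Complex.exp_nat_mul]
  push_cast
  ring_nf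

theorem arc_angle_mem (hK : 3 ≤ K) {θ : ℝ} (hθ : θ ∈ Ioo 0 (2 * halfAngle K)) :
    K * θ / 2 ∈ Ioo 0 Real.pi := by
  have hK0 : (0 : ℝ) < K := by positivity
  rw [← mul_halfAngle hK]
  constructor <;> nlinarith [hθ.1, hθ.2, mul_pos hK0 hθ.1]

theorem re_one_sub_rot_pow_pos (hK : 3 ≤ K) {θ : ℝ} (hθ : θ ∈ Ioo 0 (2 * halfAngle K)) :
    0 < (1 - rot θ ^ K).re := by
  have h := arc_angle_mem hK hθ
  have hs := Real.sin_pos_of_pos_of_lt_pi h.1 h.2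
  rw [rot_pow, one_sub_rot, Complex.re_ofReal_mul, rot_re, sub_div, Real.cos_sub_pi_div_two]
  positivity

/-- On this arc `1 - exp(iKθ)` has principal argument `(Kθ - π) / 2`, and multiplying it by `-2 / K`
gives `π / K - θ`. -/
theorem scDeriv_rot (hK : 3 ≤ K) {θ : ℝ} (hθ : θ ∈ Ioo 0 (2 * halfAngle K)) :
    ∃ ρ : ℝ, 0 < ρ ∧ scDeriv K (rot θ) = ρ * rot (halfAngle K - θ) := by
  have h := arc_angle_mem hK hθ
  have hs := Real.sin_pos_of_pos_of_lt_pi h.1 h.2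
  have hK0 : (K : ℝ) ≠ 0 := by positivity
  have hne : 1 - rot θ ^ K ≠ 0 := fun h0 => by
    have := re_one_sub_rot_pow_pos hK hθ
    rw [h0] at this
    exact lt_irrefl _ this
  have hlog : Complex.log (1 - rot θ ^ K) =
      (Real.log (2 * Real.sin (K * θ / 2)) : ℝ) + ((K * θ - Real.pi) / 2 : ℝ) * Complex.I := by
    rw [rot_pow, one_sub_rot, rot, Complex.log_ofReal_mul (by positivity) (Complex.exp_ne_zero _),
      Complex.log_exp]
    · rw [Complex.im_ofReal_mul, Complex.I_im]
      linarith [h.1, Real.pi_pos]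
    · rw [Complex.im_ofReal_mul, Complex.I_im]
      linarith [h.2, Real.pi_pos]
  refine ⟨Real.exp (Real.log (2 * Real.sin (K * θ / 2)) * -(2 / K)), Real.exp_pos _, ?_⟩
  rw [scDeriv, Complex.cpow_def_of_ne_zero hne, hlog, Complex.ofReal_exp, rot, ← Complex.exp_add]
  congr 1
  have h4 : halfAngle K - θ = (K * θ - Real.pi) / 2 * -(2 / K) := by
    rw [halfAngle]
    field_simp
    ring
  rw [h4]
  push_cast
  ring

/-- The rotation of the circle's tangent cancels the `-θ` in the argument of `scDeriv`, so the image
curve has constant direction: that of edge `0`, vertical in its frame. -/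
theorem hasDerivAt_scMap_rot (hK : 3 ≤ K) {θ : ℝ} (hθ : θ ∈ Ioo 0 (2 * halfAngle K)) :
    ∃ ρ : ℝ, 0 < ρ ∧
      HasDerivAt (fun θ => edgeFrame K 0 (scMap K (rot θ))) (ρ * Complex.I) θ := by
  obtain ⟨ρ, hρ, hsc⟩ := scDeriv_rot hK hθ
  refine ⟨ρ, hρ, ?_⟩
  have hev : ∀ᶠ z in 𝓝 (rot θ), DifferentiableAt ℂ (scDeriv K) z := by
    have hc : Continuous fun z : ℂ => (1 - z ^ K).re := by fun_prop
    filter_upwards [(hc.tendsto (rot θ)).eventually (lt_mem_nhds (re_one_sub_rot_pow_pos hK hθ))]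
      with z hz using differentiableAt_scDeriv hz
  obtain ⟨G, hG, hGe⟩ := exists_hasDerivAt_of_continuousOn_closedBall (continuousOn_scMap hK)
    (fun z hz => hasDerivAt_scMap hK hz) (norm_rot θ) hev
  have hrot : HasDerivAt rot (rot θ * Complex.I) θ := by
    have h1 : HasDerivAt (fun t : ℝ => (t : ℂ) * Complex.I) Complex.I θ := by
      simpa using (Complex.ofRealCLM.hasDerivAt (x := θ)).mul_const Complex.I
    exact h1.cexp
  have h2 := (hG.scomp θ hrot).mul_const (rot (-((2 * (0 : ℤ) + 1) * halfAngle K)))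
  have hval : (rot θ * Complex.I) • scDeriv K (rot θ) *
      rot (-((2 * (0 : ℤ) + 1) * halfAngle K)) = ρ * Complex.I := by
    have h3 : rot θ * (rot (halfAngle K - θ) * rot (-((2 * (0 : ℤ) + 1) * halfAngle K))) = 1 := by
      rw [rot_mul_rot, rot_mul_rot, ← rot_zero]
      congr 1
      push_cast
      ring
    rw [hsc, smul_eq_mul]
    linear_combination (ρ : ℂ) * Complex.I * h3
  rw [hval] at h2
  refine h2.congr_of_eventuallyEq ?_
  filter_upwards [hrot.continuousAt.eventually hGe] with t ht
  rw [edgeFrame, ht (norm_rot t).le]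
  rfl

theorem continuous_rot : Continuous rot := by
  unfold rot
  fun_prop

theorem scMap_rot_mem (hK : 3 ≤ K) {θ : ℝ} (hθ : θ ∈ Icc 0 (2 * halfAngle K)) :
    (edgeFrame K 0 (scMap K (rot θ))).re = scRadius K * Real.cos (halfAngle K) ∧
      |(edgeFrame K 0 (scMap K (rot θ))).im| ≤ scRadius K * Real.sin (halfAngle K) := by
  have hp := halfAngle_pos hK
  set E : ℝ → ℂ := fun θ => edgeFrame K 0 (scMap K (rot θ)) with hE
  have hcont : ContinuousOn E (Icc 0 (2 * halfAngle K)) := by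
    refine (continuous_edgeFrame K 0).comp_continuousOn
      ((continuousOn_scMap hK).comp continuous_rot.continuousOn fun t _ => ?_)
    rw [mem_closedBall_zero_iff, norm_rot]
  have hre : ∀ t ∈ Ioo 0 (2 * halfAngle K), HasDerivAt (fun t => (E t).re) 0 t := by
    intro t ht
    obtain ⟨ρ, -, h⟩ := hasDerivAt_scMap_rot hK ht
    have h' := Complex.reCLM.hasFDerivAt.comp_hasDerivAt t h
    rw [Complex.reCLM_apply, Complex.re_ofReal_mul, Complex.I_re, mul_zero] at h'
    exact h'
  have him : ∀ t ∈ Ioo 0 (2 * halfAngle K), ∃ ρ : ℝ, 0 < ρ ∧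
      HasDerivAt (fun t => (E t).im) ρ t := by
    intro t ht
    obtain ⟨ρ, hρ, h⟩ := hasDerivAt_scMap_rot hK ht
    refine ⟨ρ, hρ, ?_⟩
    have h' := Complex.imCLM.hasFDerivAt.comp_hasDerivAt t h
    rw [Complex.imCLM_apply, Complex.im_ofReal_mul, Complex.I_im, mul_one] at h'
    exact h'
  have hcre := Complex.continuous_re.comp_continuousOn hcont
  have hcim := Complex.continuous_im.comp_continuousOn hcont
  have hmono : MonotoneOn (fun t => (E t).re) (Icc 0 (2 * halfAngle K)) := by
    refine monotoneOn_of_deriv_nonneg (convex_Icc _ _) hcre ?_ ?_ <;> rw [interior_Icc]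
    · exact fun t ht => (hre t ht).differentiableAt.differentiableWithinAt
    · exact fun t ht => (hre t ht).deriv.ge
  have hanti : AntitoneOn (fun t => (E t).re) (Icc 0 (2 * halfAngle K)) := by
    refine antitoneOn_of_deriv_nonpos (convex_Icc _ _) hcre ?_ ?_ <;> rw [interior_Icc]
    · exact fun t ht => (hre t ht).differentiableAt.differentiableWithinAt
    · exact fun t ht => (hre t ht).deriv.le
  have hmono2 : MonotoneOn (fun t => (E t).im) (Icc 0 (2 * halfAngle K)) := by
    refine monotoneOn_of_deriv_nonneg (convex_Icc _ _) hcim ?_ ?_ <;> rw [interior_Icc]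
    · intro t ht
      obtain ⟨ρ, -, h⟩ := him t ht
      exact h.differentiableAt.differentiableWithinAt
    · intro t ht
      obtain ⟨ρ, hρ, h⟩ := him t ht
      exact hρ.le.trans_eq h.deriv.symm
  have h0m : (0 : ℝ) ∈ Icc 0 (2 * halfAngle K) := left_mem_Icc.2 (by positivity)
  have h1m : 2 * halfAngle K ∈ Icc 0 (2 * halfAngle K) := right_mem_Icc.2 (by positivity)
  have e0 : E 0 = scRadius K * rot (-halfAngle K) := by
    simp only [hE]
    rw [rot_zero, scMap_one, edgeFrame]
    simp
  have e1 : E (2 * halfAngle K) = scRadius K * rot (halfAngle K) := by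
    simp only [hE]
    have := scMap_rot_mul hK 1 1
    rw [Int.cast_one, mul_one, mul_one] at this
    rw [this, scMap_one, edgeFrame, mul_right_comm, rot_mul_rot, mul_comm]
    congr 2
    push_cast
    ring
  have r1 : (E 0).re = scRadius K * Real.cos (halfAngle K) := by
    rw [e0, Complex.re_ofReal_mul, rot_re, Real.cos_neg]
  refine ⟨le_antisymm ?_ ?_, abs_le.2 ⟨?_, ?_⟩⟩
  · exact (hanti h0m hθ hθ.1).trans_eq r1
  · exact r1.symm.trans_le (hmono h0m hθ hθ.1)
  · have h2 : (E 0).im = -(scRadius K * Real.sin (halfAngle K)) := by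
      rw [e0, Complex.im_ofReal_mul, rot_im, Real.sin_neg, mul_neg]
    exact h2.symm.trans_le (hmono2 h0m hθ hθ.1)
  · have h2 : (E (2 * halfAngle K)).im = scRadius K * Real.sin (halfAngle K) := by
      rw [e1, Complex.im_ofReal_mul, rot_im]
    exact (hmono2 hθ h1m hθ.2).trans_eq h2

/-! ### The conformal map onto the polygon. -/

/-- The conformal map of the unit disc onto the regular polygon that fixes the vertices. -/
def polygonMap (K : ℕ) (z : ℂ) : ℂ := (scRadius K)⁻¹ • scMap K z

theorem continuousOn_polygonMap (hK : 3 ≤ K) : ContinuousOn (polygonMap K) (closedBall 0 1) :=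
  (continuousOn_scMap hK).const_smul (scRadius K)⁻¹

theorem injOn_polygonMap (hK : 3 ≤ K) : InjOn (polygonMap K) (closedBall 0 1) := by
  intro a ha b hb hab
  exact injOn_scMap hK ha hb (smul_right_injective ℂ (inv_ne_zero (scRadius_pos hK).ne') hab)

theorem hasDerivAt_polygonMap (hK : 3 ≤ K) {z : ℂ} (hz : z ∈ ball (0 : ℂ) 1) :
    HasDerivAt (polygonMap K) ((scRadius K)⁻¹ • scDeriv K z) z :=
  (hasDerivAt_scMap hK hz).const_smul (scRadius K)⁻¹

theorem deriv_polygonMap_ne_zero (hK : 3 ≤ K) {z : ℂ} (hz : z ∈ ball (0 : ℂ) 1) :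
    (scRadius K)⁻¹ • scDeriv K z ≠ 0 := by
  refine smul_ne_zero (inv_ne_zero (scRadius_pos hK).ne') fun h => ?_
  have := scDeriv_re_pos hK (re_one_sub_pow_pos_of_norm_lt_one hK (mem_ball_zero_iff.1 hz))
  rw [h] at this
  exact lt_irrefl _ this

theorem analyticOnNhd_polygonMap (hK : 3 ≤ K) : AnalyticOnNhd ℂ (polygonMap K) (ball 0 1) :=
  DifferentiableOn.analyticOnNhd
    (fun _ hz => (hasDerivAt_polygonMap hK hz).differentiableAt.differentiableWithinAt) isOpen_ball

theorem polygonMap_mem_edge (hK : 3 ≤ K) {ζ : ℂ} (hζ : ζ ∈ sphere (0 : ℂ) 1) :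
    ∃ k, polygonMap K ζ ∈ edge K k := by
  have hp := halfAngle_pos hK
  have hR := scRadius_pos hK
  let k : ℤ := ⌊ζ.arg / (2 * halfAngle K)⌋
  have h1 : k * (2 * halfAngle K) ≤ ζ.arg := by
    rw [← le_div_iff₀ (by positivity)]; exact Int.floor_le _
  have h2 : ζ.arg < (k + 1) * (2 * halfAngle K) := by
    rw [← div_lt_iff₀ (by positivity)]; exact Int.lt_floor_add_one _
  refine ⟨k, (mem_edge_iff hK).2 ?_⟩
  have hζ' : ζ = rot (2 * k * halfAngle K) * rot (ζ.arg - 2 * k * halfAngle K) := by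
    rw [rot_mul_rot, add_sub_cancel]
    conv_lhs => rw [← norm_mul_rot_arg ζ, mem_sphere_zero_iff_norm.1 hζ]
    simp
  have h3 : edgeFrame K k (polygonMap K ζ) = (scRadius K)⁻¹ •
      edgeFrame K 0 (scMap K (rot (ζ.arg - 2 * k * halfAngle K))) := by
    rw [polygonMap, edgeFrame_smul]
    congr 1
    rw [hζ', scMap_rot_mul hK, ← hζ', edgeFrame, edgeFrame, mul_right_comm, rot_mul_rot, mul_comm]
    congr 2
    push_cast
    ring
  obtain ⟨h4, h5⟩ := scMap_rot_mem hK (θ := ζ.arg - 2 * k * halfAngle K)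
    ⟨by linarith, by linarith⟩
  rw [h3, Complex.smul_re, Complex.smul_im, h4, smul_eq_mul, smul_eq_mul, abs_mul,
    abs_of_pos (inv_pos.2 hR)]
  refine ⟨inv_mul_cancel_left₀ hR.ne' _, ?_⟩
  rw [inv_mul_le_iff₀ hR]
  exact h5

/-- Each half-plane inequality concerns a harmonic function of `z` and holds on the circle, hence
inside. -/
theorem polygonMap_mem_closedPolygon (hK : 3 ≤ K) {z : ℂ} (hz : z ∈ closedBall (0 : ℂ) 1) :
    polygonMap K z ∈ closedPolygon K := by
  rw [mem_closedPolygon_iff hK]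
  intro k
  have hc : ContinuousOn (fun z => -(edgeFrame K k (polygonMap K z)).re) (closedBall 0 1) :=
    (Complex.continuous_re.comp_continuousOn
      ((continuous_edgeFrame K k).comp_continuousOn (continuousOn_polygonMap hK))).neg
  have hh : InnerProductSpace.HarmonicOnNhd (fun z => -(edgeFrame K k (polygonMap K z)).re)
      (ball 0 1) := fun w hw => by
    have h1 : AnalyticAt ℂ (fun w => edgeFrame K k (polygonMap K w)) w :=
      (analyticOnNhd_polygonMap hK w hw).mul analyticAt_const
    exact h1.harmonicAt_re.neg
  have := le_of_harmonic_of_le_diff (isCompact_closedBall 0 1) isOpen_ball ball_subset_closedBall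
    hc hh (m := -Real.cos (halfAngle K)) (fun w hw => ?_) hz
  · linarith
  · have hw' : w ∈ sphere (0 : ℂ) 1 := by
      rw [← closedBall_sdiff_ball]
      exact hw
    obtain ⟨l, hl⟩ := polygonMap_mem_edge hK hw'
    have := edgeFrame_re_le hK (edge_subset_closedPolygon K l hl) k
    linarith

@[simp] theorem polygonMap_zero (K : ℕ) : polygonMap K 0 = 0 := by simp [polygonMap]

theorem isOpen_image_polygonMap (hK : 3 ≤ K) : IsOpen (polygonMap K '' ball 0 1) := by
  rcases (analyticOnNhd_polygonMap hK).is_constant_or_isOpen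
    (convex_ball (0 : ℂ) 1).isPreconnected with ⟨w, hw⟩ | h
  · exfalso
    have h0 : (0 : ℂ) ∈ ball (0 : ℂ) 1 := by simp
    have h1 : (1 / 2 : ℂ) ∈ ball (0 : ℂ) 1 := by simp; norm_num
    have := injOn_polygonMap hK (ball_subset_closedBall h0) (ball_subset_closedBall h1)
      ((hw 0 h0).trans (hw _ h1).symm)
    norm_num at this
  · exact h _ Subset.rfl isOpen_ball

theorem polygonMap_mem_polygon (hK : 3 ≤ K) {z : ℂ} (hz : z ∈ ball (0 : ℂ) 1) :
    polygonMap K z ∈ polygon K := by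
  refine interior_maximal ?_ (isOpen_image_polygonMap hK) (mem_image_of_mem _ hz)
  rintro _ ⟨w, hw, rfl⟩
  exact polygonMap_mem_closedPolygon hK (ball_subset_closedBall hw)

/-- Connectedness: the image is open, and relatively closed in `polygon K` because limit points
coming from the circle lie on edges. -/
theorem polygon_subset_image (hK : 3 ≤ K) : polygon K ⊆ polygonMap K '' ball 0 1 := by
  refine (convex_polygon K).isPreconnected.subset_of_closure_inter_subset
    (isOpen_image_polygonMap hK) ⟨0, zero_mem_polygon hK, 0, by simp, polygonMap_zero K⟩ ?_
  rintro w ⟨hw, hwP⟩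
  have hcomp : IsCompact (polygonMap K '' closedBall 0 1) :=
    (isCompact_closedBall 0 1).image_of_continuousOn (continuousOn_polygonMap hK)
  obtain ⟨z, hz, rfl⟩ := closure_minimal (image_mono ball_subset_closedBall) hcomp.isClosed hw
  by_cases hzb : z ∈ ball (0 : ℂ) 1
  · exact mem_image_of_mem _ hzb
  · have hzs : z ∈ sphere (0 : ℂ) 1 := by
      rw [← closedBall_sdiff_ball]
      exact ⟨hz, hzb⟩
    obtain ⟨k, hk⟩ := polygonMap_mem_edge hK hzs
    exact absurd hwP (notMem_polygon_of_mem_edge hK hk)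

theorem image_polygonMap (hK : 3 ≤ K) : polygonMap K '' closedBall 0 1 = closedPolygon K := by
  refine Subset.antisymm ?_ ?_
  · rintro _ ⟨z, hz, rfl⟩
    exact polygonMap_mem_closedPolygon hK hz
  · have hcomp : IsCompact (polygonMap K '' closedBall 0 1) :=
      (isCompact_closedBall 0 1).image_of_continuousOn (continuousOn_polygonMap hK)
    have h1 : closure (polygon K) = closedPolygon K := by
      rw [polygon, (convex_closedPolygon K).closure_interior_eq_closure_of_nonempty_interior
        ⟨0, zero_mem_polygon hK⟩, (isCompact_closedPolygon hK).isClosed.closure_eq]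
    rw [← h1]
    exact closure_minimal ((polygon_subset_image hK).trans (image_mono ball_subset_closedBall))
      hcomp.isClosed

end

/-! ### The inverse map and the Dirichlet problem on the polygon. -/

/-- The inverse of `polygonMap K` on the closed polygon. -/
def polygonInv (K : ℕ) : ℂ → ℂ := Function.invFunOn (polygonMap K) (closedBall 0 1)

section

variable {K : ℕ}

theorem polygonInv_mem (hK : 3 ≤ K) {z : ℂ} (hz : z ∈ closedPolygon K) :
    polygonInv K z ∈ closedBall (0 : ℂ) 1 := by
  rw [← image_polygonMap hK] at hz
  exact Function.invFunOn_mem hz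

theorem polygonMap_polygonInv (hK : 3 ≤ K) {z : ℂ} (hz : z ∈ closedPolygon K) :
    polygonMap K (polygonInv K z) = z := by
  rw [← image_polygonMap hK] at hz
  exact Function.invFunOn_eq hz

theorem polygonInv_mem_ball (hK : 3 ≤ K) {z : ℂ} (hz : z ∈ polygon K) :
    polygonInv K z ∈ ball (0 : ℂ) 1 := by
  obtain ⟨w, hw, rfl⟩ := polygon_subset_image hK hz
  rwa [polygonInv, (injOn_polygonMap hK).leftInvOn_invFunOn (ball_subset_closedBall hw)]

theorem polygonInv_mem_sphere (hK : 3 ≤ K) {z : ℂ} {k : ℤ} (hz : z ∈ edge K k) :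
    polygonInv K z ∈ sphere (0 : ℂ) 1 := by
  have hz' := edge_subset_closedPolygon K k hz
  rw [← closedBall_sdiff_ball]
  refine ⟨polygonInv_mem hK hz', fun h => notMem_polygon_of_mem_edge hK hz ?_⟩
  rw [← polygonMap_polygonInv hK hz']
  exact polygonMap_mem_polygon hK h

theorem continuousOn_polygonInv (hK : 3 ≤ K) : ContinuousOn (polygonInv K) (closedPolygon K) := by
  rw [continuousOn_iff_isClosed]
  intro t ht
  refine ⟨polygonMap K '' (closedBall 0 1 ∩ t), ?_, ?_⟩
  · exact (((isCompact_closedBall 0 1).inter_right ht).image_of_continuousOn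
      ((continuousOn_polygonMap hK).mono inter_subset_left)).isClosed
  · ext z
    constructor
    · rintro ⟨hz1, hz2⟩
      exact ⟨⟨polygonInv K z, ⟨polygonInv_mem hK hz2, hz1⟩, polygonMap_polygonInv hK hz2⟩, hz2⟩
    · rintro ⟨⟨w, ⟨hw, hwt⟩, rfl⟩, hz2⟩
      refine ⟨?_, hz2⟩
      rwa [mem_preimage, polygonInv, (injOn_polygonMap hK).leftInvOn_invFunOn hw]

theorem analyticOnNhd_polygonInv (hK : 3 ≤ K) : AnalyticOnNhd ℂ (polygonInv K) (polygon K) := by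
  refine DifferentiableOn.analyticOnNhd (fun z hz => ?_) (isOpen_polygon K)
  have hcont : ContinuousAt (polygonInv K) z :=
    (continuousOn_polygonInv hK).continuousAt (mem_of_superset
      ((isOpen_polygon K).mem_nhds hz) (polygon_subset K))
  have hb := polygonInv_mem_ball hK hz
  refine (HasDerivAt.of_local_left_inverse hcont (hasDerivAt_polygonMap hK hb)
    (deriv_polygonMap_ne_zero hK hb) ?_).differentiableAt.differentiableWithinAt
  filter_upwards [(isOpen_polygon K).mem_nhds hz] with w hw
  exact polygonMap_polygonInv hK (polygon_subset K hw)

/-- The Dirichlet problem on the regular polygon. -/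
theorem exists_harmonic_polygon (hK : 3 ≤ K) {g : ℂ → ℝ} (hg : ContinuousOn g (⋃ k, edge K k)) :
    ∃ h : ℂ → ℝ, ContinuousOn h (closedPolygon K) ∧ HarmonicOnNhd h (polygon K) ∧
      ∀ k, ∀ z ∈ edge K k, h z = g z := by
  have hmaps : MapsTo (polygonMap K) (sphere 0 1) (⋃ k, edge K k) := fun ζ hζ =>
    mem_iUnion.2 (polygonMap_mem_edge hK hζ)
  have hgc : ContinuousOn (fun ζ => g (polygonMap K ζ)) (sphere 0 1) :=
    hg.comp ((continuousOn_polygonMap hK).mono sphere_subset_closedBall) hmaps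
  obtain ⟨h, H, hc, hH, hball, hsph⟩ := exists_harmonic_disc hgc
  refine ⟨fun z => h (polygonInv K z), ?_, ?_, ?_⟩
  · exact hc.comp (continuousOn_polygonInv hK) fun z hz => polygonInv_mem hK hz
  · intro z hz
    have h1 : AnalyticAt ℂ (fun w => H (polygonInv K w)) z :=
      (hH _ (polygonInv_mem_ball hK hz)).comp (analyticOnNhd_polygonInv hK z hz)
    refine (harmonicAt_congr_nhds ?_).1 h1.harmonicAt_re
    filter_upwards [(isOpen_polygon K).mem_nhds hz] with w hw
    exact (hball _ (polygonInv_mem_ball hK hw)).symm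
  · intro k z hz
    change h (polygonInv K z) = g z
    rw [hsph _ (polygonInv_mem_sphere hK hz),
      polygonMap_polygonInv hK (edge_subset_closedPolygon K k hz)]

end

/-! ### The boundary datum in complex form; existence and uniqueness. -/

/-- The tent function of height one and radius `d` centred at `w`. -/
def tent (d : ℝ) (w z : ℂ) : ℝ := max 0 (1 - dist z w / d)

theorem continuous_tent (d : ℝ) (w : ℂ) : Continuous (tent d w) := by
  unfold tent
  fun_prop

theorem tent_le_one {d : ℝ} (hd : 0 < d) (w z : ℂ) : tent d w z ≤ 1 :=
  max_le zero_le_one (by have : 0 ≤ dist z w / d := by positivity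
                         linarith)

theorem tent_eq_zero {d : ℝ} (hd : 0 < d) {w z : ℂ} (h : d ≤ dist z w) : tent d w z = 0 :=
  max_eq_left (by rw [sub_nonpos, le_div_iff₀ hd, one_mul]; exact h)

theorem tent_eq_of_dist_le {d : ℝ} (hd : 0 < d) {w z : ℂ} (h : dist z w ≤ d) :
    tent d w z = 1 - dist z w / d :=
  max_eq_right (by rw [sub_nonneg, div_le_iff₀ hd, one_mul]; exact h)

@[simp] theorem tent_self (d : ℝ) (w : ℂ) : tent d w w = 1 := by simp [tent]

/-- The boundary datum on the edge `k`, as a complex number: the value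
`s * rot ((2 * k + 1) * β)` on the edge is interpolated towards the average of the values on
adjacent edges at the vertices. -/
def boundaryValue (K : ℕ) (s d β : ℝ) (k : ℤ) (z : ℂ) : ℂ :=
  s * (rot ((2 * k + 1) * β) - Complex.I * Real.sin β * rot (2 * k * β) * tent d (vertex K k) z
    + Complex.I * Real.sin β * rot (2 * (k + 1) * β) * tent d (vertex K (k + 1)) z)

/-- The symmetric traceless matrix encoded by a complex number. -/
def complexTensor (w : ℂ) : Matrix (Fin 2) (Fin 2) ℝ := pTensor w.re w.im

theorem complexTensor_add (w z : ℂ) :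
    complexTensor (w + z) = complexTensor w + complexTensor z := by
  ext i j
  fin_cases i <;> fin_cases j <;> simp [complexTensor, pTensor, add_comm]

theorem complexTensor_smul (t : ℝ) (w : ℂ) : complexTensor (t * w) = t • complexTensor w := by
  ext i j
  fin_cases i <;> fin_cases j <;> simp [complexTensor, pTensor]

theorem pTensor_eq_iff {a b a' b' : ℝ} : pTensor a b = pTensor a' b' ↔ a = a' ∧ b = b' := by
  refine ⟨fun h => ⟨?_, ?_⟩, fun h => by rw [h.1, h.2]⟩
  · simpa [pTensor] using congrFun (congrFun h 0) 0
  · simpa [pTensor] using congrFun (congrFun h 0) 1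

/-- Angle doubling: for `n = exp(iφ)` the entries of `2 (n ⊗ n) - I` are `cos 2φ` and `sin 2φ`. -/
theorem directorTensor_eq (s : ℝ) {n : ℂ} (hn : ‖n‖ = 1) :
    directorTensor s n = complexTensor (s * n ^ 2) := by
  have h : n.re * n.re + n.im * n.im = 1 := by
    rw [← Complex.normSq_apply, Complex.normSq_eq_norm_sq, hn, one_pow]
  ext i j
  fin_cases i <;> fin_cases j <;>
    simp [directorTensor, complexTensor, pTensor, outer, sq] <;>
    first | ring1 | linear_combination s * h

section

variable {K : ℕ}

theorem vertex_succ_sub (K : ℕ) (k : ℤ) : vertex K (k + 1) - vertex K k =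
    (2 * Real.sin (halfAngle K) : ℝ) * (Complex.I * rot ((2 * k + 1) * halfAngle K)) := by
  have h1 : vertex K (k + 1) = rot ((2 * k + 1) * halfAngle K) * rot (halfAngle K) := by
    rw [vertex_eq_rot, rot_mul_rot]; congr 1; push_cast; ring
  have h2 : vertex K k = rot ((2 * k + 1) * halfAngle K) * rot (-halfAngle K) := by
    rw [vertex_eq_rot, rot_mul_rot]; congr 1; ring
  have h3 : rot (halfAngle K) - rot (-halfAngle K) =
      (2 * Real.sin (halfAngle K) : ℝ) * Complex.I := by
    apply Complex.ext
    · simp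
    · simp [Complex.sin_ofReal_re]; ring
  rw [h1, h2, ← mul_sub, h3]
  ring

theorem dist_vertex_succ (hK : 3 ≤ K) (k : ℤ) :
    dist (vertex K k) (vertex K (k + 1)) = 2 * Real.sin (halfAngle K) := by
  have := sin_halfAngle_pos hK
  rw [dist_comm, dist_eq_norm, vertex_succ_sub, norm_mul, norm_mul, Complex.norm_I, norm_rot,
    Complex.norm_of_nonneg (by positivity), mul_one, mul_one]

theorem tangent_eq (hK : 3 ≤ K) (k : ℤ) :
    tangent K k = Complex.I * rot ((2 * k + 1) * halfAngle K) := by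
  have hs := sin_halfAngle_pos hK
  rw [tangent, ← dist_eq_norm, dist_comm, dist_vertex_succ hK, vertex_succ_sub, Complex.real_smul,
    ← mul_assoc, ← Complex.ofReal_mul, inv_mul_cancel₀ (by positivity), Complex.ofReal_one, one_mul]

theorem edgeValue_eq (hK : 3 ≤ K) (s : ℝ) (k : ℤ) :
    edgeValue K s k = complexTensor (-(s * rot ((2 * k + 1) * (2 * halfAngle K)))) := by
  rw [edgeValue, directorTensor_eq, tangent_eq hK, mul_pow, Complex.I_sq, rot_pow]
  · congr 1
    rw [neg_one_mul, mul_neg]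
    congr 3
    push_cast
    ring
  · rw [tangent_eq hK]
    simp

theorem rot_add_add_rot_sub (a b : ℝ) : rot (a - b) + rot (a + b) = 2 * Real.cos b * rot a := by
  have h : rot (-b) + rot b = 2 * Real.cos b := by
    apply Complex.ext <;> simp [two_mul, Complex.cos_ofReal_re]
  rw [sub_eq_add_neg, rot_add, rot_add, ← mul_add, h]
  ring

theorem vertexValue_eq (hK : 3 ≤ K) (s : ℝ) (k : ℤ) : vertexValue K s k = complexTensor
    (-(s * (Real.cos (2 * halfAngle K) * rot (2 * k * (2 * halfAngle K))))) := by
  rw [vertexValue, edgeValue_eq hK, edgeValue_eq hK, ← complexTensor_add, ← complexTensor_smul]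
  congr 1
  have h := rot_add_add_rot_sub (2 * k * (2 * halfAngle K)) (2 * halfAngle K)
  have h1 : (2 * (k - 1 : ℤ) + 1) * (2 * halfAngle K) =
      2 * k * (2 * halfAngle K) - 2 * halfAngle K := by push_cast; ring
  have h2 : (2 * k + 1) * (2 * halfAngle K) =
      2 * k * (2 * halfAngle K) + 2 * halfAngle K := by ring
  rw [h1, h2]
  push_cast at h ⊢
  linear_combination (-(s : ℂ) / 2) * h

theorem lt_dist_of_dist_le (hK : 3 ≤ K) {d : ℝ} (hdK : d < Real.sin (halfAngle K)) {k : ℤ} {z : ℂ}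
    (h : dist z (vertex K k) ≤ d) : d < dist z (vertex K (k + 1)) := by
  have h1 := dist_triangle_left (vertex K k) (vertex K (k + 1)) z
  rw [dist_vertex_succ hK] at h1
  linarith

theorem rot_eq (a : ℝ) : rot a = Real.cos a + Real.sin a * Complex.I := by
  apply Complex.ext <;> simp [Complex.cos_ofReal_re, Complex.sin_ofReal_re]

/-- The minus sign is the square of the factor `i` that turns normals into tangents. Since `rot
((2k+1)β) - i sin β rot (2kβ) = cos β rot (2kβ)`, a full tent gives the average at a vertex; as
edges have length `2 sin (π / K) > 2d`, at most one tent is nonzero. -/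
theorem boundaryTensor_eq (hK : 3 ≤ K) {s d : ℝ} (hd : 0 < d) (hdK : d < Real.sin (halfAngle K))
    (k : ℤ) (z : ℂ) : boundaryTensor K s d k z =
      complexTensor (-boundaryValue K s d (2 * halfAngle K) k z) := by
  rw [boundaryTensor, boundaryValue]
  have e1 : rot ((2 * k + 1) * (2 * halfAngle K)) = rot (2 * k * (2 * halfAngle K)) *
      (Real.cos (2 * halfAngle K) + Real.sin (2 * halfAngle K) * Complex.I) := by
    rw [← rot_eq, rot_mul_rot]; congr 1; ring
  have e2 : rot ((2 * k + 1) * (2 * halfAngle K)) = rot (2 * (k + 1) * (2 * halfAngle K)) *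
      (Real.cos (2 * halfAngle K) - Real.sin (2 * halfAngle K) * Complex.I) := by
    have : (Real.cos (2 * halfAngle K) - Real.sin (2 * halfAngle K) * Complex.I : ℂ) =
        rot (-(2 * halfAngle K)) := by
      rw [rot_eq, Real.cos_neg, Real.sin_neg]; push_cast; ring
    rw [this, rot_mul_rot]; congr 1; ring
  split_ifs with h1 h2
  · have h3 := lt_dist_of_dist_le hK hdK h1
    rw [tent_eq_zero hd h3.le, tent_eq_of_dist_le hd h1, vertexValue_eq hK, edgeValue_eq hK,
      ← complexTensor_smul, ← complexTensor_smul, ← complexTensor_add]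
    congr 1
    rw [e1]
    push_cast
    ring
  · rw [not_le] at h1
    rw [tent_eq_zero hd h1.le, tent_eq_of_dist_le hd h2, vertexValue_eq hK, edgeValue_eq hK,
      ← complexTensor_smul, ← complexTensor_smul, ← complexTensor_add]
    congr 1
    rw [e2]
    push_cast
    ring
  · rw [not_le] at h1 h2
    rw [tent_eq_zero hd h1.le, tent_eq_zero hd h2.le, edgeValue_eq hK]
    congr 1
    push_cast
    ring

theorem continuous_boundaryValue (K : ℕ) (s d β : ℝ) (k : ℤ) :
    Continuous (boundaryValue K s d β k) := by
  have h1 := continuous_tent d (vertex K k)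
  have h2 := continuous_tent d (vertex K (k + 1))
  unfold boundaryValue
  fun_prop

theorem boundaryValue_add_mul (hK : 3 ≤ K) (s d : ℝ) (k n : ℤ) (z : ℂ) :
    boundaryValue K s d (2 * halfAngle K) (k + n * K) z =
      boundaryValue K s d (2 * halfAngle K) k z := by
  have h : ∀ a : ℝ, rot ((a + 2 * (n * K)) * (2 * halfAngle K)) = rot (a * (2 * halfAngle K)) := by
    intro a
    have h1 : (a + 2 * (n * K)) * (2 * halfAngle K) =
        a * (2 * halfAngle K) + (2 * n : ℤ) * (2 * Real.pi) := by
      rw [← mul_halfAngle hK]; push_cast; ring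
    rw [h1, rot_add, rot_int_mul_two_pi, mul_one]
  have e1 := h (2 * k + 1)
  have e2 := h (2 * k)
  have e3 := h (2 * (k + 1))
  rw [boundaryValue, boundaryValue, add_right_comm k, vertex_add_mul hK, vertex_add_mul hK, ← e1,
    ← e2, ← e3]
  push_cast
  ring_nf

theorem boundaryValue_vertex_succ (hK : 3 ≤ K) {s d : ℝ} (hd : 0 < d)
    (hdK : d < Real.sin (halfAngle K)) (β : ℝ) (k : ℤ) :
    boundaryValue K s d β k (vertex K (k + 1)) =
      boundaryValue K s d β (k + 1) (vertex K (k + 1)) := by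
  have hs := sin_halfAngle_pos hK
  have h1 : tent d (vertex K k) (vertex K (k + 1)) = 0 := by
    apply tent_eq_zero hd
    rw [dist_comm, dist_vertex_succ hK]
    linarith
  have h2 : tent d (vertex K (k + 1 + 1)) (vertex K (k + 1)) = 0 := by
    apply tent_eq_zero hd
    rw [dist_vertex_succ hK]
    linarith
  rw [boundaryValue, boundaryValue, h1, h2, tent_self]
  have e1 : rot ((2 * k + 1) * β) = rot (2 * (k + 1) * β) * (Real.cos β - Real.sin β * Complex.I) := by
    have : (Real.cos β - Real.sin β * Complex.I : ℂ) = rot (-β) := by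
      rw [rot_eq, Real.cos_neg, Real.sin_neg]; push_cast; ring
    rw [this, rot_mul_rot]; congr 1; ring
  have e2 : rot ((2 * (k + 1 : ℤ) + 1) * β) =
      rot (2 * (k + 1) * β) * (Real.cos β + Real.sin β * Complex.I) := by
    rw [← rot_eq, rot_mul_rot]; congr 1; push_cast; ring
  rw [e1, e2]
  push_cast
  ring

theorem boundaryValue_eq_of_mem_edge (hK : 3 ≤ K) {s d : ℝ} (hd : 0 < d)
    (hdK : d < Real.sin (halfAngle K)) {k l : ℤ} {z : ℂ} (hk : z ∈ edge K k) (hl : z ∈ edge K l) :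
    boundaryValue K s d (2 * halfAngle K) k z = boundaryValue K s d (2 * halfAngle K) l z := by
  rcases eq_or_eq_of_mem_edge hK hk hl with ⟨n, rfl⟩ | ⟨rfl, n, rfl⟩ | ⟨rfl, n, hn⟩
  · exact boundaryValue_add_mul hK s d l n z
  · rw [add_right_comm, ← boundaryValue_vertex_succ hK hd hdK, boundaryValue_add_mul hK]
  · rw [boundaryValue_vertex_succ hK hd hdK]
    conv_lhs => arg 5; rw [hn]
    exact boundaryValue_add_mul hK s d l n _

theorem isClosed_edge (hK : 3 ≤ K) (k : ℤ) : IsClosed (edge K k) := by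
  have : edge K k = {z | (edgeFrame K k z).re = Real.cos (halfAngle K)} ∩
      {z | |(edgeFrame K k z).im| ≤ Real.sin (halfAngle K)} := by
    ext z
    exact mem_edge_iff hK
  rw [this]
  have h := continuous_edgeFrame K k
  exact (isClosed_eq (by fun_prop) (by fun_prop)).inter (isClosed_le (by fun_prop) (by fun_prop))

theorem iUnion_edge (hK : 3 ≤ K) : (⋃ k : ℤ, edge K k) = ⋃ i : Fin K, edge K (i : ℕ) := by
  refine Subset.antisymm (iUnion_subset fun k => ?_)
    (iUnion_subset fun i => subset_iUnion (edge K) _)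
  have hK0 : (0 : ℤ) < K := by omega
  have h0 := Int.emod_nonneg k hK0.ne'
  have h1 := Int.emod_lt_of_pos k hK0
  have h2 : edge K k = edge K ((k % K).toNat : ℕ) := by
    rw [Int.toNat_of_nonneg h0, ← edge_add_mul hK (k % K) (k / K), mul_comm,
      Int.emod_add_mul_ediv]
  rw [h2]
  exact subset_iUnion (fun i : Fin K => edge K (i : ℕ)) ⟨(k % K).toNat, by omega⟩

theorem exists_continuousOn_boundaryValue (hK : 3 ≤ K) (s : ℝ) {d : ℝ} (hd : 0 < d)
    (hdK : d < Real.sin (halfAngle K)) : ∃ g : ℂ → ℂ, ContinuousOn g (⋃ k, edge K k) ∧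
      ∀ k, ∀ z ∈ edge K k, g z = boundaryValue K s d (2 * halfAngle K) k z := by
  classical
  -- The choice of edge is immaterial by `boundaryValue_eq_of_mem_edge`, and the value `0` off the
  -- edges is never used. Continuity follows by gluing over finitely many closed edges.
  let g : ℂ → ℂ := fun z => if h : ∃ k, z ∈ edge K k then
    boundaryValue K s d (2 * halfAngle K) h.choose z else 0
  have hg : ∀ k, ∀ z ∈ edge K k, g z = boundaryValue K s d (2 * halfAngle K) k z := by
    intro k z hz
    have h : ∃ k, z ∈ edge K k := ⟨k, hz⟩
    simp only [g, dif_pos h]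
    exact boundaryValue_eq_of_mem_edge hK hd hdK h.choose_spec hz
  refine ⟨g, ?_, hg⟩
  rw [iUnion_edge hK]
  exact (locallyFinite_of_finite _).continuousOn_iUnion (fun i => isClosed_edge hK _)
    fun i => (continuous_boundaryValue K s d _ _).continuousOn.congr (hg _)

theorem exists_isSolution (hK : 3 ≤ K) (s : ℝ) {d : ℝ} (hd : 0 < d)
    (hdK : d < Real.sin (halfAngle K)) : ∃ P₁₁ P₁₂ : ℂ → ℝ, IsSolution K s d P₁₁ P₁₂ := by
  obtain ⟨g, hgc, hg⟩ := exists_continuousOn_boundaryValue hK s hd hdK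
  obtain ⟨P, hPc, hPh, hP⟩ := exists_harmonic_polygon hK (g := fun z => -(g z).re)
    (Complex.continuous_re.comp_continuousOn hgc).neg
  obtain ⟨Q, hQc, hQh, hQ⟩ := exists_harmonic_polygon hK (g := fun z => -(g z).im)
    (Complex.continuous_im.comp_continuousOn hgc).neg
  refine ⟨P, Q, hPc, hQc, hPh, hQh, fun k z hz => ?_⟩
  rw [hP k z hz, hQ k z hz, hg k z hz, boundaryTensor_eq hK hd hdK]
  rfl

/-- Uniqueness for the Dirichlet problem on the regular polygon. -/
theorem eq_of_eq_on_edges (hK : 3 ≤ K) {f g : ℂ → ℝ} (hf : ContinuousOn f (closedPolygon K))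
    (hg : ContinuousOn g (closedPolygon K)) (hfh : HarmonicOnNhd f (polygon K))
    (hgh : HarmonicOnNhd g (polygon K)) (h : ∀ k, ∀ z ∈ edge K k, f z = g z) {z : ℂ}
    (hz : z ∈ closedPolygon K) : f z = g z := by
  have key : ∀ f g : ℂ → ℝ, ContinuousOn f (closedPolygon K) → ContinuousOn g (closedPolygon K) →
      HarmonicOnNhd f (polygon K) → HarmonicOnNhd g (polygon K) →
      (∀ k, ∀ z ∈ edge K k, f z = g z) → g z ≤ f z := by
    intro f g hf hg hfh hgh h
    have := le_of_harmonic_of_le_diff (isCompact_closedPolygon hK) (isOpen_polygon K)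
      (polygon_subset K) (hf.sub hg) (hfh.sub hgh) (m := 0) (fun w hw => by
        obtain ⟨k, hk⟩ := exists_mem_edge hK hw.1 hw.2
        rw [Pi.sub_apply, h k w hk, sub_self]) hz
    exact sub_nonneg.1 this
  exact le_antisymm (key g f hg hf hgh hfh fun k z hz => (h k z hz).symm) (key f g hf hg hfh hgh h)

end

/-! ### Reflection symmetry of the solution. -/

section

variable {K : ℕ}

/-- The reflection of the plane in the line through the origin of argument `m * halfAngle K`. -/
def reflection (K : ℕ) (m : ℤ) (z : ℂ) : ℂ := rot (2 * m * halfAngle K) * conj z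

theorem edgeFrame_reflection (K : ℕ) (m k : ℤ) (z : ℂ) :
    edgeFrame K k (reflection K m z) = conj (edgeFrame K (m - k - 1) z) := by
  rw [edgeFrame, reflection, edgeFrame, map_mul, conj_rot, mul_right_comm, rot_mul_rot, mul_comm]
  congr 2
  push_cast
  ring

theorem reflection_reflection (K : ℕ) (m : ℤ) (z : ℂ) :
    reflection K m (reflection K m z) = z := by
  rw [reflection, reflection, map_mul, conj_rot, Complex.conj_conj, ← mul_assoc, rot_mul_rot,
    add_neg_cancel, rot_zero, one_mul]

theorem dist_reflection (K : ℕ) (m : ℤ) (z w : ℂ) :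
    dist (reflection K m z) (reflection K m w) = dist z w := by
  rw [reflection, reflection, dist_eq_norm, ← mul_sub, ← map_sub, norm_mul, norm_rot, one_mul,
    Complex.norm_conj, dist_eq_norm]

theorem reflection_vertex (K : ℕ) (m k : ℤ) :
    reflection K m (vertex K k) = vertex K (m - k) := by
  rw [reflection, vertex_eq_rot, vertex_eq_rot, conj_rot, rot_mul_rot]
  congr 1
  push_cast
  ring

theorem tent_reflection (K : ℕ) (d : ℝ) (m k : ℤ) (z : ℂ) :
    tent d (vertex K k) (reflection K m z) = tent d (vertex K (m - k)) z := by
  rw [tent, tent, ← sub_sub_cancel m k, ← reflection_vertex, dist_reflection, sub_sub_cancel]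

theorem reflection_mem_edge (hK : 3 ≤ K) (m : ℤ) {k : ℤ} {z : ℂ} (hz : z ∈ edge K k) :
    reflection K m z ∈ edge K (m - k - 1) := by
  rw [mem_edge_iff hK] at hz ⊢
  rw [edgeFrame_reflection, Complex.conj_re, Complex.conj_im, abs_neg]
  rwa [show m - (m - k - 1) - 1 = k by ring]

theorem reflection_mem_closedPolygon (hK : 3 ≤ K) (m : ℤ) {z : ℂ} (hz : z ∈ closedPolygon K) :
    reflection K m z ∈ closedPolygon K := by
  rw [mem_closedPolygon_iff hK] at hz ⊢
  intro k
  rw [edgeFrame_reflection, Complex.conj_re]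
  exact hz _

theorem reflection_mem_polygon (hK : 3 ≤ K) (m : ℤ) {z : ℂ} (hz : z ∈ polygon K) :
    reflection K m z ∈ polygon K := by
  by_contra hn
  obtain ⟨k, hk⟩ := exists_mem_edge hK
    (reflection_mem_closedPolygon hK m (polygon_subset K hz)) hn
  have := reflection_mem_edge hK m hk
  rw [reflection_reflection] at this
  exact notMem_polygon_of_mem_edge hK this hz

theorem continuous_reflection (K : ℕ) (m : ℤ) : Continuous (reflection K m) := by
  unfold reflection
  fun_prop

/-- Reflection `m` sends vertex `k` to vertex `m - k`, so edge `k` goes to edge `m - k - 1` with its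
ends exchanged. The exchange of the two tents matches the sign change of `i` under conjugation. -/
theorem boundaryValue_reflection (K : ℕ) (s d β : ℝ) (m k : ℤ) (z : ℂ) :
    boundaryValue K s d β (m - k - 1) (reflection K m z) =
      rot (2 * m * β) * conj (boundaryValue K s d β k z) := by
  have e1 : rot ((2 * (m - k - 1 : ℤ) + 1) * β) = rot (2 * m * β) * rot (-((2 * k + 1) * β)) := by
    rw [rot_mul_rot]; congr 1; push_cast; ring
  have e2 : rot (2 * (m - k - 1 : ℤ) * β) = rot (2 * m * β) * rot (-(2 * (k + 1) * β)) := by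
    rw [rot_mul_rot]; congr 1; push_cast; ring
  have e3 : rot (2 * ((m - k - 1 : ℤ) + 1) * β) = rot (2 * m * β) * rot (-(2 * k * β)) := by
    rw [rot_mul_rot]; congr 1; push_cast; ring
  rw [boundaryValue, boundaryValue, tent_reflection, tent_reflection, e1, e2, e3,
    show m - (m - k - 1) = k + 1 by ring, show m - (m - k - 1 + 1) = k by ring]
  simp only [map_mul, map_add, map_sub, Complex.conj_ofReal, Complex.conj_I, conj_rot]
  ring

/-- A complex-valued harmonic function on the polygon with the boundary datum
`boundaryValue K s d β`. -/
structure IsComplexSolution (K : ℕ) (s d β : ℝ) (v : ℂ → ℂ) : Prop where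
  continuousOn : ContinuousOn v (closedPolygon K)
  harmonic : HarmonicOnNhd v (polygon K)
  boundary : ∀ k, ∀ z ∈ edge K k, v z = boundaryValue K s d β k z

namespace IsComplexSolution

variable {s d β : ℝ} {v w : ℂ → ℂ}

theorem eq (hK : 3 ≤ K) (hv : IsComplexSolution K s d β v) (hw : IsComplexSolution K s d β w)
    {z : ℂ} (hz : z ∈ closedPolygon K) : v z = w z := by
  apply Complex.ext
  · exact eq_of_eq_on_edges hK (Complex.continuous_re.comp_continuousOn hv.continuousOn)
      (Complex.continuous_re.comp_continuousOn hw.continuousOn)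
      (hv.harmonic.comp_CLM Complex.reCLM) (hw.harmonic.comp_CLM Complex.reCLM)
      (fun k z hz => by simp [hv.boundary k z hz, hw.boundary k z hz]) hz
  · exact eq_of_eq_on_edges hK (Complex.continuous_im.comp_continuousOn hv.continuousOn)
      (Complex.continuous_im.comp_continuousOn hw.continuousOn)
      (hv.harmonic.comp_CLM Complex.imCLM) (hw.harmonic.comp_CLM Complex.imCLM)
      (fun k z hz => by simp [hv.boundary k z hz, hw.boundary k z hz]) hz

theorem reflect (hK : 3 ≤ K) (hv : IsComplexSolution K s d β v) (m : ℤ) :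
    IsComplexSolution K s d β fun z => rot (2 * m * β) * conj (v (reflection K m z)) where
  continuousOn := by
    refine continuousOn_const.mul (Complex.continuous_conj.comp_continuousOn ?_)
    exact hv.continuousOn.comp (continuous_reflection K m).continuousOn
      fun z hz => reflection_mem_closedPolygon hK m hz
  harmonic := fun z hz => by
    have h1 : HarmonicAt (fun z => v (reflection K m z)) z :=
      harmonicAt_complex_comp_mul_conj _ (hv.harmonic _ (reflection_mem_polygon hK m hz))
    exact h1.comp_CLM ((ContinuousLinearMap.mul ℝ ℂ (rot (2 * m * β))).comp
      (Complex.conjCLE : ℂ →L[ℝ] ℂ))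
  boundary := fun k z hz => by
    rw [hv.boundary _ _ (reflection_mem_edge hK m hz), boundaryValue_reflection, map_mul, conj_rot,
      Complex.conj_conj, ← mul_assoc, rot_mul_rot, add_neg_cancel, rot_zero, one_mul]

theorem eq_reflect (hK : 3 ≤ K) (hv : IsComplexSolution K s d β v) (m : ℤ) {z : ℂ}
    (hz : z ∈ closedPolygon K) : v z = rot (2 * m * β) * conj (v (reflection K m z)) :=
  hv.eq hK (hv.reflect hK m) hz

/-- Reflections `0` and `1` both fix the origin, giving `v 0 = conj (v 0) = rot (2β) * conj (v 0)`.
-/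
theorem apply_zero (hK : 3 ≤ K) (hv : IsComplexSolution K s d β v) (hβ : rot (2 * β) ≠ 1) :
    v 0 = 0 := by
  have h0 := hv.eq_reflect hK 0 (zero_mem_closedPolygon hK)
  have h1 := hv.eq_reflect hK 1 (zero_mem_closedPolygon hK)
  simp only [reflection, map_zero, mul_zero, Int.cast_zero, zero_mul, rot_zero, one_mul,
    Int.cast_one, mul_one] at h0 h1
  rw [← h0] at h1
  by_contra hne
  exact hβ (mul_right_cancel₀ hne (h1.symm.trans (one_mul _).symm))

/-- On the line of argument `m * halfAngle K` the values are real multiples of `rot (m * β)`. -/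
theorem eq_on_ray (hK : 3 ≤ K) (hv : IsComplexSolution K s d β v) (m : ℤ) {r : ℝ}
    (hz : (r : ℂ) * rot (m * halfAngle K) ∈ closedPolygon K) :
    v (r * rot (m * halfAngle K)) =
      ((rot (-(m * β)) * v (r * rot (m * halfAngle K))).re : ℂ) * rot (m * β) := by
  set z : ℂ := r * rot (m * halfAngle K) with hzdef
  have hfix : reflection K m z = z := by
    rw [reflection, hzdef, map_mul, Complex.conj_ofReal, conj_rot, mul_left_comm, rot_mul_rot]
    congr 2
    ring
  have h1 := hv.eq_reflect hK m hz
  rw [hfix] at h1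
  have h2 : conj (rot (-(m * β)) * v z) = rot (-(m * β)) * v z := by
    conv_rhs => rw [h1, ← mul_assoc, rot_mul_rot]
    rw [map_mul, conj_rot, neg_neg]
    congr 2
    ring
  rw [Complex.conj_eq_iff_re.1 h2, mul_right_comm, rot_mul_rot, neg_add_cancel, rot_zero, one_mul]

end IsComplexSolution

/-! ### Sectors and the boundary values of the components. -/

/-- The component of `v` along the direction `rot (j * β)`. -/
def component (β : ℝ) (v : ℂ → ℂ) (j : ℤ) (z : ℂ) : ℝ := (rot (-(j * β)) * v z).re

/-- The part of the open sector around the direction `j * halfAngle K` inside the polygon. -/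
def openSector (K : ℕ) (j : ℤ) : Set ℂ :=
  polygon K ∩ ({z | 0 < (z * rot (-((j - 1 : ℤ) * halfAngle K))).im} ∩
    {z | (z * rot (-((j + 1 : ℤ) * halfAngle K))).im < 0})

theorem isOpen_openSector (K : ℕ) (j : ℤ) : IsOpen (openSector K j) :=
  (isOpen_polygon K).inter
    ((isOpen_lt (by fun_prop) (by fun_prop)).inter (isOpen_lt (by fun_prop) (by fun_prop)))

theorem convex_openSector (K : ℕ) (j : ℤ) : Convex ℝ (openSector K j) := by
  have h : ∀ b : ℂ, ∀ s : Set ℝ, Convex ℝ s → Convex ℝ {z : ℂ | (z * b).im ∈ s} := fun b s hs =>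
    hs.linear_preimage (Complex.imCLM.toLinearMap.comp (LinearMap.mulRight ℝ b))
  exact (convex_polygon K).inter ((h _ _ (convex_Ioi 0)).inter (h _ _ (convex_Iio 0)))

theorem im_mul_rot_pred (K : ℕ) (j : ℤ) (z : ℂ) :
    (z * rot (-((j - 1 : ℤ) * halfAngle K))).im =
      (z * rot (-(j * halfAngle K))).re * Real.sin (halfAngle K) +
        (z * rot (-(j * halfAngle K))).im * Real.cos (halfAngle K) := by
  have h : z * rot (-((j - 1 : ℤ) * halfAngle K)) =
      z * rot (-(j * halfAngle K)) * rot (halfAngle K) := by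
    rw [mul_assoc, rot_mul_rot]; congr 2; push_cast; ring
  rw [h, Complex.mul_im _ (rot (halfAngle K)), rot_re, rot_im]

theorem im_mul_rot_succ (K : ℕ) (j : ℤ) (z : ℂ) :
    (z * rot (-((j + 1 : ℤ) * halfAngle K))).im =
      -((z * rot (-(j * halfAngle K))).re * Real.sin (halfAngle K)) +
        (z * rot (-(j * halfAngle K))).im * Real.cos (halfAngle K) := by
  have h : z * rot (-((j + 1 : ℤ) * halfAngle K)) =
      z * rot (-(j * halfAngle K)) * rot (-halfAngle K) := by
    rw [mul_assoc, rot_mul_rot]; congr 2; push_cast; ring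
  rw [h, Complex.mul_im _ (rot (-halfAngle K)), rot_re, rot_im, Real.cos_neg, Real.sin_neg]
  ring

theorem openSector_subset (K : ℕ) (hK : 3 ≤ K) (j : ℤ) :
    openSector K j ⊆ sector K j ∩ closedPolygon K := by
  rintro z ⟨hz, h1, h2⟩
  refine ⟨?_, polygon_subset K hz⟩
  rw [mem_ofPred_eq, im_mul_rot_pred] at h1
  rw [mem_ofPred_eq, im_mul_rot_succ] at h2
  rw [sector, mem_ofPred_eq, ← abs_of_pos (cos_halfAngle_pos hK), ← abs_mul,
    abs_le]
  constructor <;> linarith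

/-- A point of a sector that is not in the open sector is on the boundary of the polygon or on one
of the rays that bound the sector. -/
theorem mem_ray_of_notMem_openSector (hK : 3 ≤ K) {j : ℤ} {z : ℂ} (hz : z ∈ sector K j)
    (hzP : z ∈ polygon K) (hn : z ∉ openSector K j) :
    ∃ r : ℝ, 0 ≤ r ∧ (z = r * rot ((j - 1 : ℤ) * halfAngle K) ∨
      z = r * rot ((j + 1 : ℤ) * halfAngle K)) := by
  have hs := sin_halfAngle_pos hK
  have hc := cos_halfAngle_pos hK
  rw [sector, mem_ofPred_eq] at hz
  have hre0 : 0 ≤ (z * rot (-(j * halfAngle K))).re := by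
    have : 0 ≤ |(z * rot (-(j * halfAngle K))).im| * Real.cos (halfAngle K) := by positivity
    exact nonneg_of_mul_nonneg_left (this.trans hz) hs
  rw [← abs_of_pos hc, ← abs_mul, abs_le] at hz
  have hback : ∀ a : ℝ, z * rot (-a) * rot a = z := fun a => by
    rw [mul_assoc, rot_mul_rot, neg_add_cancel, rot_zero, mul_one]
  have hray : ∀ i : ℤ, (z * rot (-(i * halfAngle K))).im = 0 →
      z = ((z * rot (-(i * halfAngle K))).re : ℂ) * rot (i * halfAngle K) := fun i hi => by
    have : (((z * rot (-(i * halfAngle K))).re : ℝ) : ℂ) = z * rot (-(i * halfAngle K)) :=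
      Complex.ext (Complex.ofReal_re _) ((Complex.ofReal_im _).trans hi.symm)
    rw [this, hback]
  have hshift : ∀ (i : ℤ) (a : ℝ), (i : ℝ) * halfAngle K = j * halfAngle K + a →
      z * rot (-(i * halfAngle K)) = z * rot (-(j * halfAngle K)) * rot (-a) := fun i a h => by
    rw [mul_assoc, rot_mul_rot, h]; congr 2; ring
  by_cases h1 : 0 < (z * rot (-((j - 1 : ℤ) * halfAngle K))).im
  · have h2 : ¬ (z * rot (-((j + 1 : ℤ) * halfAngle K))).im < 0 := fun h2 => hn ⟨hzP, h1, h2⟩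
    have h3 : (z * rot (-((j + 1 : ℤ) * halfAngle K))).im = 0 := by
      refine le_antisymm ?_ (not_lt.1 h2)
      rw [im_mul_rot_succ]
      linarith
    refine ⟨_, ?_, Or.inr (hray _ h3)⟩
    rw [im_mul_rot_succ] at h3
    rw [hshift (j + 1) (halfAngle K) (by push_cast; ring), Complex.mul_re _ (rot _), rot_re, rot_im,
      Real.cos_neg, Real.sin_neg]
    have h4 : 0 ≤ (z * rot (-(j * halfAngle K))).im * Real.cos (halfAngle K) := by
      have := mul_nonneg hre0 hs.le
      linarith
    have h5 := nonneg_of_mul_nonneg_left h4 hc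
    have := mul_nonneg hre0 hc.le
    have := mul_nonneg h5 hs.le
    linarith
  · have h3 : (z * rot (-((j - 1 : ℤ) * halfAngle K))).im = 0 := by
      refine le_antisymm (not_lt.1 h1) ?_
      rw [im_mul_rot_pred]
      linarith
    refine ⟨_, ?_, Or.inl (hray _ h3)⟩
    rw [im_mul_rot_pred] at h3
    rw [hshift (j - 1) (-halfAngle K) (by push_cast; ring), Complex.mul_re _ (rot _), rot_re,
      rot_im, neg_neg]
    have h4 : 0 ≤ -(z * rot (-(j * halfAngle K))).im * Real.cos (halfAngle K) := by
      have := mul_nonneg hre0 hs.le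
      linarith
    have h5 := nonneg_of_mul_nonneg_left h4 hc
    have := mul_nonneg hre0 hc.le
    have := mul_nonneg h5 hs.le
    linarith

theorem mul_rot_mem_openSector (hK : 3 ≤ K) {j : ℤ} {r : ℝ} (hr : 0 < r)
    (hP : (r : ℂ) * rot (j * halfAngle K) ∈ polygon K) :
    (r : ℂ) * rot (j * halfAngle K) ∈ openSector K j := by
  have hs := sin_halfAngle_pos hK
  have h : (r : ℂ) * rot (j * halfAngle K) * rot (-(j * halfAngle K)) = r := by
    rw [mul_assoc, rot_mul_rot, add_neg_cancel, rot_zero, mul_one]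
  refine ⟨hP, ?_, ?_⟩
  · rw [mem_ofPred_eq, im_mul_rot_pred, h, Complex.ofReal_re, Complex.ofReal_im]
    nlinarith
  · rw [mem_ofPred_eq, im_mul_rot_succ, h, Complex.ofReal_re, Complex.ofReal_im]
    nlinarith

theorem mul_rot_mem_sector (hK : 3 ≤ K) {j : ℤ} {r : ℝ} (hr : 0 ≤ r) :
    (r : ℂ) * rot (j * halfAngle K) ∈ sector K j := by
  have hs := sin_halfAngle_pos hK
  have h : (r : ℂ) * rot (j * halfAngle K) * rot (-(j * halfAngle K)) = r := by
    rw [mul_assoc, rot_mul_rot, add_neg_cancel, rot_zero, mul_one]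
  rw [sector, mem_ofPred_eq, h, Complex.ofReal_re, Complex.ofReal_im, abs_zero, zero_mul]
  positivity

/-- The axis of every sector meets the boundary of the polygon. -/
theorem exists_mul_rot_mem_edge (hK : 3 ≤ K) (j : ℤ) :
    ∃ r : ℝ, 0 < r ∧ ∃ k, (r : ℂ) * rot (j * halfAngle K) ∈ edge K k := by
  rcases Int.even_or_odd' j with ⟨k, rfl | rfl⟩
  · refine ⟨1, one_pos, k, ?_⟩
    have := vertex_mem_edge K k
    rw [vertex_eq_rot] at this
    push_cast
    rwa [one_mul]
  · refine ⟨Real.cos (halfAngle K), cos_halfAngle_pos hK, k, ?_⟩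
    have h : edgeFrame K k (Real.cos (halfAngle K) * rot ((2 * k + 1 : ℤ) * halfAngle K)) =
        Real.cos (halfAngle K) := by
      rw [edgeFrame, mul_assoc, rot_mul_rot]
      push_cast
      rw [add_neg_cancel, rot_zero, mul_one]
    rw [mem_edge_iff hK, h, Complex.ofReal_re, Complex.ofReal_im, abs_zero]
    exact ⟨rfl, (sin_halfAngle_pos hK).le⟩

theorem dist_edgeFrame (K : ℕ) (k : ℤ) (z w : ℂ) :
    dist (edgeFrame K k z) (edgeFrame K k w) = dist z w := by
  rw [dist_eq_norm, dist_eq_norm, edgeFrame, edgeFrame, ← sub_mul, norm_mul, norm_rot, mul_one]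

theorem sin_le_dist_vertex_succ (K : ℕ) {k : ℤ} {z : ℂ} (h : (edgeFrame K k z).im ≤ 0) :
    Real.sin (halfAngle K) ≤ dist z (vertex K (k + 1)) := by
  have h1 : edgeFrame K k (vertex K (k + 1)) = rot (halfAngle K) := by
    rw [edgeFrame_vertex]; congr 1; push_cast; ring
  rw [← dist_edgeFrame K k, h1, dist_comm, dist_eq_norm]
  refine le_trans ?_ (Complex.im_le_norm _)
  rw [Complex.sub_im, rot_im]
  linarith

theorem sin_le_dist_vertex (K : ℕ) {k : ℤ} {z : ℂ} (h : 0 ≤ (edgeFrame K k z).im) :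
    Real.sin (halfAngle K) ≤ dist z (vertex K k) := by
  have h1 : edgeFrame K k (vertex K k) = rot (-halfAngle K) := by
    rw [edgeFrame_vertex]; congr 1; push_cast; ring
  rw [← dist_edgeFrame K k, h1, dist_eq_norm]
  refine le_trans ?_ (Complex.im_le_norm _)
  rw [Complex.sub_im, rot_im, Real.sin_neg]
  linarith

theorem tent_add_tent_le_one (hK : 3 ≤ K) {d : ℝ} (hd : 0 < d) (hdK : d < Real.sin (halfAngle K))
    (k : ℤ) (z : ℂ) : tent d (vertex K k) z + tent d (vertex K (k + 1)) z ≤ 1 := by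
  by_cases h : dist z (vertex K k) ≤ d
  · rw [tent_eq_zero hd (lt_dist_of_dist_le hK hdK h).le, add_zero]
    exact tent_le_one hd _ _
  · rw [tent_eq_zero hd (not_le.1 h).le, zero_add]
    exact tent_le_one hd _ _

theorem re_rot_mul_boundaryValue_odd (K : ℕ) (s d β : ℝ) (k : ℤ) (z : ℂ) :
    (rot (-((2 * k + 1 : ℤ) * β)) * boundaryValue K s d β k z).re =
      s * (1 - Real.sin β ^ 2 * (tent d (vertex K k) z + tent d (vertex K (k + 1)) z)) := by
  have e1 : rot (-((2 * k + 1 : ℤ) * β)) * rot ((2 * k + 1) * β) = 1 := by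
    rw [rot_mul_rot, ← rot_zero]; congr 1; push_cast; ring
  have e2 : rot (-((2 * k + 1 : ℤ) * β)) * rot (2 * k * β) = rot (-β) := by
    rw [rot_mul_rot]; congr 1; push_cast; ring
  have e3 : rot (-((2 * k + 1 : ℤ) * β)) * rot (2 * (k + 1) * β) = rot β := by
    rw [rot_mul_rot]; congr 1; push_cast; ring
  have e : rot (-((2 * k + 1 : ℤ) * β)) * boundaryValue K s d β k z =
      (s : ℂ) * (1 - ((Real.sin β * tent d (vertex K k) z : ℝ) : ℂ) * (Complex.I * rot (-β)) +
        ((Real.sin β * tent d (vertex K (k + 1)) z : ℝ) : ℂ) * (Complex.I * rot β)) := by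
    rw [boundaryValue, ← e1, ← e2, ← e3]
    push_cast
    ring
  rw [e, Complex.re_ofReal_mul, Complex.add_re, Complex.sub_re, Complex.re_ofReal_mul,
    Complex.re_ofReal_mul, Complex.I_mul_re, Complex.I_mul_re, rot_im, rot_im, Real.sin_neg,
    Complex.one_re]
  ring

/-- Near vertex `k` the interpolation moves the datum only along `i rot (2kβ)`, orthogonally to the
direction of the component, which therefore stays constant. -/
theorem re_rot_mul_boundaryValue_left (K : ℕ) (s β : ℝ) {d : ℝ} {k : ℤ} {z : ℂ}
    (h : tent d (vertex K (k + 1)) z = 0) :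
    (rot (-((2 * k : ℤ) * β)) * boundaryValue K s d β k z).re = s * Real.cos β := by
  have e1 : rot (-((2 * k : ℤ) * β)) * rot ((2 * k + 1) * β) = rot β := by
    rw [rot_mul_rot]; congr 1; push_cast; ring
  have e2 : rot (-((2 * k : ℤ) * β)) * rot (2 * k * β) = 1 := by
    rw [rot_mul_rot, ← rot_zero]; congr 1; push_cast; ring
  have e : rot (-((2 * k : ℤ) * β)) * boundaryValue K s d β k z =
      (s : ℂ) * (rot β - ((Real.sin β * tent d (vertex K k) z : ℝ) : ℂ) * Complex.I) := by
    rw [boundaryValue, h, ← e1]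
    push_cast at e2 ⊢
    linear_combination
      (-(s : ℂ) * Complex.I * Complex.sin β * (tent d (vertex K k) z : ℂ)) * e2
  rw [e, Complex.re_ofReal_mul, Complex.sub_re, Complex.re_ofReal_mul, Complex.I_re, rot_re,
    mul_zero, sub_zero]

theorem re_rot_mul_boundaryValue_right (K : ℕ) (s β : ℝ) {d : ℝ} {k : ℤ} {z : ℂ}
    (h : tent d (vertex K k) z = 0) :
    (rot (-((2 * (k + 1) : ℤ) * β)) * boundaryValue K s d β k z).re = s * Real.cos β := by
  have e1 : rot (-((2 * (k + 1) : ℤ) * β)) * rot ((2 * k + 1) * β) = rot (-β) := by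
    rw [rot_mul_rot]; congr 1; push_cast; ring
  have e2 : rot (-((2 * (k + 1) : ℤ) * β)) * rot (2 * (k + 1) * β) = 1 := by
    rw [rot_mul_rot, ← rot_zero]; congr 1; push_cast; ring
  have e : rot (-((2 * (k + 1) : ℤ) * β)) * boundaryValue K s d β k z = (s : ℂ) *
      (rot (-β) + ((Real.sin β * tent d (vertex K (k + 1)) z : ℝ) : ℂ) * Complex.I) := by
    rw [boundaryValue, h, ← e1]
    push_cast at e2 ⊢
    linear_combination
      ((s : ℂ) * Complex.I * Complex.sin β * (tent d (vertex K (k + 1)) z : ℂ)) * e2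
  rw [e, Complex.re_ofReal_mul, Complex.add_re, Complex.re_ofReal_mul, Complex.I_re, rot_re,
    Real.cos_neg, mul_zero, add_zero]

end

/-! ### Positivity of the components and absence of zeros. -/

section

variable {K : ℕ}

namespace IsComplexSolution

variable {s d β : ℝ} {v : ℂ → ℂ}

theorem continuousOn_component (hv : IsComplexSolution K s d β v) (j : ℤ) :
    ContinuousOn (component β v j) (closedPolygon K) :=
  Complex.continuous_re.comp_continuousOn (continuousOn_const.mul hv.continuousOn)

theorem harmonic_component (hv : IsComplexSolution K s d β v) (j : ℤ) :
    HarmonicOnNhd (component β v j) (polygon K) :=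
  HarmonicOnNhd.re_mul hv.harmonic _

/-- For even `j` the component is exactly `s cos β`; for odd `j` it is `s (1 - sin² β · T)`, where
`T ≤ 1` is the sum of the two tents. -/
theorem le_component_of_notMem_polygon (hK : 3 ≤ K) (hs : 0 < s) (hd : 0 < d)
    (hdK : d < Real.sin (halfAngle K)) (hβ : 0 ≤ Real.cos β) (hv : IsComplexSolution K s d β v)
    {j : ℤ} {z : ℂ} (hz : z ∈ sector K j) (hzK : z ∈ closedPolygon K) (hzP : z ∉ polygon K) :
    s * Real.cos β ^ 2 ≤ component β v j z := by
  have hle : s * Real.cos β ^ 2 ≤ s * Real.cos β := by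
    have := Real.cos_le_one β
    have : Real.cos β ^ 2 ≤ Real.cos β := by nlinarith
    gcongr
  rw [component]
  rcases Int.even_or_odd' j with ⟨k, rfl | rfl⟩
  · rcases mem_sector_odd_of_even hK hz with ⟨h1, h2⟩ | ⟨h1, h2⟩
    · have hedge := mem_edge_of_mem_sector hK hzK h1 hzP
      have := re_rot_mul_boundaryValue_right K s β (k := k - 1)
        (tent_eq_zero hd (hdK.le.trans (sin_le_dist_vertex K h2)))
      rw [sub_add_cancel] at this
      rw [hv.boundary _ _ hedge, this]
      exact hle
    · have hedge := mem_edge_of_mem_sector hK hzK h1 hzP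
      rw [hv.boundary _ _ hedge, re_rot_mul_boundaryValue_left K s β
        (tent_eq_zero hd (hdK.le.trans (sin_le_dist_vertex_succ K h2)))]
      exact hle
  · have hedge := mem_edge_of_mem_sector hK hzK hz hzP
    rw [hv.boundary _ _ hedge, re_rot_mul_boundaryValue_odd]
    refine mul_le_mul_of_nonneg_left ?_ hs.le
    have h1 := tent_add_tent_le_one hK hd hdK k z
    have h2 := Real.sin_sq_add_cos_sq β
    nlinarith [sq_nonneg (Real.sin β)]

/-- By `eq_on_ray` the value is a real multiple of `rot (m * β)`, a direction at angle `±β` from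
`rot (j * β)`. -/
theorem component_on_ray (hK : 3 ≤ K) (hv : IsComplexSolution K s d β v) {j m : ℤ}
    (hm : m = j - 1 ∨ m = j + 1) {r : ℝ} (hz : (r : ℂ) * rot (m * halfAngle K) ∈ closedPolygon K) :
    component β v j (r * rot (m * halfAngle K)) =
      Real.cos β * component β v m (r * rot (m * halfAngle K)) := by
  have h := hv.eq_on_ray hK m hz
  rw [component, h, mul_left_comm, rot_mul_rot, Complex.re_ofReal_mul, rot_re, mul_comm, component]
  congr 1
  rcases hm with rfl | rfl
  · rw [← Real.cos_neg]; congr 1; push_cast; ring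
  · congr 1; push_cast; ring

/-- Minimum principle on one sector. On a bounding ray the assumed bound is used for the
neighbouring sector, whose axis is that ray, and the factor `cos β` is gained. -/
theorem component_lower_bound_step (hK : 3 ≤ K) (hs : 0 < s) (hd : 0 < d)
    (hdK : d < Real.sin (halfAngle K)) (hβ : 0 ≤ Real.cos β) (hv : IsComplexSolution K s d β v)
    {A : ℝ} (hA : 0 ≤ A) (h : ∀ j, ∀ z ∈ sector K j ∩ closedPolygon K, -A ≤ component β v j z)
    (j : ℤ) {z : ℂ} (hz : z ∈ sector K j ∩ closedPolygon K) :
    -(Real.cos β * A) ≤ component β v j z := by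
  refine le_of_harmonic_of_le_diff
    ((isCompact_closedPolygon hK).inter_left (isClosed_sector K j)) (isOpen_openSector K j)
    (openSector_subset K hK j) ((hv.continuousOn_component j).mono inter_subset_right)
    (fun w hw => hv.harmonic_component j w hw.1) (fun w hw => ?_) hz
  by_cases hwP : w ∈ polygon K
  · obtain ⟨r, hr, hray⟩ := mem_ray_of_notMem_openSector hK hw.1.1 hwP hw.2
    obtain ⟨m, hm, rfl⟩ : ∃ m : ℤ, (m = j - 1 ∨ m = j + 1) ∧ w = r * rot (m * halfAngle K) := by
      rcases hray with h | h
      · exact ⟨j - 1, Or.inl rfl, h⟩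
      · exact ⟨j + 1, Or.inr rfl, h⟩
    rw [hv.component_on_ray hK hm hw.1.2, ← mul_neg]
    exact mul_le_mul_of_nonneg_left (h m _ ⟨mul_rot_mem_sector hK hr, hw.1.2⟩) hβ
  · have h1 := hv.le_component_of_notMem_polygon hK hs hd hdK hβ hw.1.1 hw.1.2 hwP
    have h2 : 0 ≤ s * Real.cos β ^ 2 := by positivity
    have h3 : 0 ≤ Real.cos β * A := by positivity
    linarith

/-- In every sector the component along the corresponding direction is nonnegative. -/
theorem component_nonneg (hK : 3 ≤ K) (hs : 0 < s) (hd : 0 < d)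
    (hdK : d < Real.sin (halfAngle K)) (hβ : 0 ≤ Real.cos β) (hβ1 : Real.cos β < 1)
    (hv : IsComplexSolution K s d β v) {j : ℤ} {z : ℂ} (hz : z ∈ sector K j ∩ closedPolygon K) :
    0 ≤ component β v j z := by
  obtain ⟨A, hA⟩ := (isCompact_closedPolygon hK).exists_bound_of_continuousOn hv.continuousOn
  have hA0 : 0 ≤ A := (norm_nonneg _).trans (hA 0 (zero_mem_closedPolygon hK))
  have hind : ∀ n : ℕ, ∀ j, ∀ z ∈ sector K j ∩ closedPolygon K,
      -(Real.cos β ^ n * A) ≤ component β v j z := by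
    intro n
    induction n with
    | zero =>
      intro j z hz
      rw [pow_zero, one_mul]
      have h1 := Complex.abs_re_le_norm (rot (-(j * β)) * v z)
      rw [norm_mul, norm_rot, one_mul] at h1
      exact neg_le_of_abs_le (h1.trans (hA z hz.2))
    | succ n ih =>
      intro j z hz
      rw [pow_succ', mul_assoc]
      exact hv.component_lower_bound_step hK hs hd hdK hβ (by positivity) ih j hz
  have hlim : Tendsto (fun n : ℕ => -(Real.cos β ^ n * A)) atTop (𝓝 0) := by
    simpa using ((tendsto_pow_atTop_nhds_zero_of_lt_one hβ hβ1).mul_const A).neg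
  exact le_of_tendsto' hlim fun n => hind n j z hz

/-- A zero would make the component vanish on the whole open sector and, by continuity along the
axis, at a point of the boundary where it is at least `s cos² β > 0`. -/
theorem component_pos (hK : 3 ≤ K) (hs : 0 < s) (hd : 0 < d)
    (hdK : d < Real.sin (halfAngle K)) (hβ : 0 < Real.cos β) (hβ1 : Real.cos β < 1)
    (hv : IsComplexSolution K s d β v) {j : ℤ} {z : ℂ} (hz : z ∈ openSector K j) :
    0 < component β v j z := by
  have hsub := openSector_subset K hK j
  refine (hv.component_nonneg hK hs hd hdK hβ.le hβ1 (hsub hz)).lt_of_ne fun h0 => ?_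
  have hzero : ∀ w ∈ openSector K j, component β v j w = 0 := fun w hw =>
    eq_zero_of_harmonic_of_nonneg (isOpen_openSector K j) (convex_openSector K j).isPreconnected
      (fun x hx => hv.harmonic_component j x hx.1)
      (fun x hx => hv.component_nonneg hK hs hd hdK hβ.le hβ1 (hsub hx)) hz h0.symm hw
  obtain ⟨r, hr, k, hk⟩ := exists_mul_rot_mem_edge hK j
  set e : ℂ := r * rot (j * halfAngle K) with he
  have heK := edge_subset_closedPolygon K k hk
  have hpos := hv.le_component_of_notMem_polygon hK hs hd hdK hβ.le
    (mul_rot_mem_sector hK hr.le) heK (notMem_polygon_of_mem_edge hK hk)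
  have hmem : ∀ᶠ t : ℝ in 𝓝[<] 1, (t : ℂ) * e ∈ openSector K j := by
    have h2 : ∀ᶠ t : ℝ in 𝓝 1, 0 < t := lt_mem_nhds one_pos
    filter_upwards [h2.filter_mono nhdsWithin_le_nhds, self_mem_nhdsWithin] with t ht0 ht1
    have h3 := smul_mem_polygon hK heK ht0.le ht1
    rw [Complex.real_smul] at h3
    have h4 : (t : ℂ) * e = ((t * r : ℝ) : ℂ) * rot (j * halfAngle K) := by
      rw [he]; push_cast; ring
    rw [h4] at h3 ⊢
    exact mul_rot_mem_openSector hK (mul_pos ht0 hr) h3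
  have hmap : Tendsto (fun t : ℝ => (t : ℂ) * e) (𝓝[<] 1) (𝓝[closedPolygon K] e) := by
    refine tendsto_nhdsWithin_iff.2 ⟨?_, hmem.mono fun t ht => (hsub ht).2⟩
    have hc : Continuous fun t : ℝ => (t : ℂ) * e := by fun_prop
    simpa using (hc.tendsto 1).mono_left nhdsWithin_le_nhds
  have hlim := (hv.continuousOn_component j e heK).tendsto.comp hmap
  have hlim0 : Tendsto (component β v j ∘ fun t : ℝ => (t : ℂ) * e) (𝓝[<] 1) (𝓝 0) :=
    tendsto_const_nhds.congr' (hmem.mono fun t ht => (hzero _ ht).symm)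
  rw [tendsto_nhds_unique hlim hlim0] at hpos
  have : 0 < s * Real.cos β ^ 2 := by positivity
  linarith

theorem ne_zero (hK : 3 ≤ K) (hs : 0 < s) (hd : 0 < d)
    (hdK : d < Real.sin (halfAngle K)) (hβ : 0 < Real.cos β) (hβ1 : Real.cos β < 1)
    (hv : IsComplexSolution K s d β v) {z : ℂ} (hz : z ∈ closedPolygon K) (hz0 : z ≠ 0) :
    v z ≠ 0 := by
  intro hvz
  have hcomp : ∀ j, component β v j z = 0 := fun j => by
    rw [component, hvz, mul_zero, Complex.zero_re]
  obtain ⟨k, hk⟩ := exists_mem_sector_odd hK z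
  by_cases hzP : z ∈ polygon K
  · have hno : ∀ j, z ∉ openSector K j := fun j hj => by
      have := hv.component_pos hK hs hd hdK hβ hβ1 hj
      rw [hcomp] at this
      exact lt_irrefl _ this
    -- A nonzero interior point outside the open sector of an edge is on a bounding ray, which is
    -- the axis of an adjacent open sector.
    obtain ⟨r, hr, hray⟩ := mem_ray_of_notMem_openSector hK hk hzP (hno _)
    have hr0 : 0 < r := hr.lt_of_ne fun h => hz0 (by rcases hray with h' | h' <;> simp [h', ← h])
    rcases hray with h | h <;> rw [h] at hzP <;> have h' := mul_rot_mem_openSector hK hr0 hzP <;>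
      rw [← h] at h' <;> exact hno _ h'
  · have := hv.le_component_of_notMem_polygon hK hs hd hdK hβ.le hk hz hzP
    rw [hcomp] at this
    have : 0 < s * Real.cos β ^ 2 := by positivity
    linarith

end IsComplexSolution

end

/-! ### Return to the tensor field: the centre, the triangle and the square. -/

namespace IsSolution

variable {K : ℕ} {s d : ℝ} {P₁₁ P₁₂ : ℂ → ℝ}

theorem harmonic_complex (h : IsSolution K s d P₁₁ P₁₂) :
    HarmonicOnNhd (fun z => (⟨P₁₁ z, P₁₂ z⟩ : ℂ)) (polygon K) := fun z hz =>
  harmonicAt_complex_iff.2 ⟨h.harmonic₁₁ z hz, h.harmonic₁₂ z hz⟩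

theorem continuousOn_complex (h : IsSolution K s d P₁₁ P₁₂) :
    ContinuousOn (fun z => (⟨P₁₁ z, P₁₂ z⟩ : ℂ)) (closedPolygon K) := by
  have := (Complex.continuous_ofReal.comp_continuousOn h.continuousOn₁₁).add
    ((Complex.continuous_ofReal.comp_continuousOn h.continuousOn₁₂).mul
      (continuousOn_const (c := Complex.I)))
  exact this.congr fun z _ => Complex.mk_eq_add_mul_I _ _

theorem boundary_complex (hK : 3 ≤ K) (hd : 0 < d) (hdK : d < Real.sin (halfAngle K))
    (h : IsSolution K s d P₁₁ P₁₂) (k : ℤ) (z : ℂ) (hz : z ∈ edge K k) :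
    (⟨P₁₁ z, P₁₂ z⟩ : ℂ) = -boundaryValue K s d (2 * halfAngle K) k z := by
  have h1 := h.boundary k z hz
  rw [boundaryTensor_eq hK hd hdK, complexTensor, pTensor_eq_iff] at h1
  exact Complex.ext h1.1 h1.2

theorem isComplexSolution_neg (hK : 3 ≤ K) (hd : 0 < d) (hdK : d < Real.sin (halfAngle K))
    (h : IsSolution K s d P₁₁ P₁₂) :
    IsComplexSolution K s d (2 * halfAngle K) fun z => -(⟨P₁₁ z, P₁₂ z⟩ : ℂ) where
  continuousOn := h.continuousOn_complex.neg
  harmonic := h.harmonic_complex.neg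
  boundary := fun k z hz => by rw [h.boundary_complex hK hd hdK k z hz, neg_neg]

/-- With `3p = π`, the angle `-2(2k+1)p` equals `(2k+1)p + π` modulo `2π`, so conjugation and the
sign change replace `β = 2p` by `β = p`, whose cosine is positive. -/
theorem conj_boundaryValue_triangle (s d : ℝ) (k : ℤ) (z : ℂ) :
    conj (-boundaryValue 3 s d (2 * halfAngle 3) k z) = boundaryValue 3 s d (halfAngle 3) k z := by
  have hp := mul_halfAngle (le_refl 3)
  set p := halfAngle 3
  push_cast at hp
  have hs : Real.sin (2 * p) = Real.sin p := by
    rw [← Real.sin_pi_sub, ← hp]; congr 1; ring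
  have e1 : rot (-((2 * k + 1) * (2 * p))) = -rot ((2 * k + 1) * p) := by
    have h1 : -((2 * k + 1) * (2 * p)) =
        (2 * k + 1) * p + (-k - 1 : ℤ) * (2 * Real.pi) + Real.pi := by
      rw [← hp]; push_cast; ring
    have h2 : rot Real.pi = -1 := by apply Complex.ext <;> simp
    rw [h1, rot_add, rot_add, rot_int_mul_two_pi, h2]
    ring
  have e2 : ∀ l : ℤ, rot (-(2 * l * (2 * p))) = rot (2 * l * p) := fun l => by
    have h1 : -(2 * l * (2 * p)) = 2 * l * p + (-l : ℤ) * (2 * Real.pi) := by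
      rw [← hp]; push_cast; ring
    rw [h1, rot_add, rot_int_mul_two_pi, mul_one]
  have e3 := e2 (k + 1)
  push_cast at e3
  rw [boundaryValue, boundaryValue]
  simp only [map_neg, map_mul, map_add, map_sub, Complex.conj_ofReal, Complex.conj_I, conj_rot]
  rw [e1, e2, e3, hs]
  ring

theorem isComplexSolution_conj (hd : 0 < d) (hdK : d < Real.sin (halfAngle 3))
    (h : IsSolution 3 s d P₁₁ P₁₂) :
    IsComplexSolution 3 s d (halfAngle 3) fun z => conj (⟨P₁₁ z, P₁₂ z⟩ : ℂ) where
  continuousOn := Complex.continuous_conj.comp_continuousOn h.continuousOn_complex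
  harmonic := h.harmonic_complex.comp_CLM (Complex.conjCLE : ℂ →L[ℝ] ℂ)
  boundary := fun k z hz => by
    rw [h.boundary_complex le_rfl hd hdK k z hz, conj_boundaryValue_triangle]

theorem apply_zero (hK : 3 ≤ K) (hd : 0 < d) (hdK : d < Real.sin (halfAngle K))
    (h : IsSolution K s d P₁₁ P₁₂) : P₁₁ 0 = 0 ∧ P₁₂ 0 = 0 := by
  have hne : rot (2 * (2 * halfAngle K)) ≠ 1 := fun h1 => by
    have h2 := congrArg Complex.re h1
    rw [rot_re, Complex.one_re, Real.cos_two_mul] at h2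
    have hp := halfAngle_pos hK
    have hp3 := halfAngle_le hK
    have h3 : Real.cos (2 * halfAngle K) ^ 2 = 1 := by linarith
    have h4 : 0 < Real.sin (2 * halfAngle K) :=
      Real.sin_pos_of_pos_of_lt_pi (by linarith) (by linarith [Real.pi_pos])
    have h5 := Real.sin_sq_add_cos_sq (2 * halfAngle K)
    have h6 : 0 < Real.sin (2 * halfAngle K) ^ 2 := by positivity
    linarith
  have h0 := (h.isComplexSolution_neg hK hd hdK).apply_zero hK hne
  rw [neg_eq_zero] at h0
  exact ⟨congrArg Complex.re h0, congrArg Complex.im h0⟩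

/-- The component argument needs an acute `β`: `π / 3` after conjugation for the triangle, and `2π /
K` for `K ≥ 5`. For `K = 4` the angle `2π / K` is exactly right. -/
theorem ne_zero (hK : 3 ≤ K) (hK4 : K ≠ 4) (hs : 0 < s) (hd : 0 < d)
    (hdK : d < Real.sin (halfAngle K)) (h : IsSolution K s d P₁₁ P₁₂) {z : ℂ}
    (hz : z ∈ closedPolygon K) (hz0 : z ≠ 0) : (P₁₁ z, P₁₂ z) ≠ (0, 0) := by
  intro hP
  rw [Prod.mk.injEq] at hP
  have hpi := Real.pi_pos
  have hp := halfAngle_pos hK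
  have hcos : ∀ β : ℝ, 0 < β → β < Real.pi / 2 → 0 < Real.cos β ∧ Real.cos β < 1 := by
    intro β h1 h2
    refine ⟨Real.cos_pos_of_mem_Ioo ⟨by linarith, h2⟩, ?_⟩
    rw [← Real.cos_zero]
    exact Real.cos_lt_cos_of_nonneg_of_le_pi_div_two le_rfl h2.le h1
  rcases hK.eq_or_lt with rfl | hK3
  · obtain ⟨h1, h2⟩ := hcos (halfAngle 3) hp (by linarith [halfAngle_le hK])
    refine (h.isComplexSolution_conj hd hdK).ne_zero hK hs hd hdK h1 h2 hz hz0 ?_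
    simp only [hP.1, hP.2]
    exact map_zero _
  · have hK5 : (5 : ℝ) ≤ K := by
      have : 5 ≤ K := by omega
      exact_mod_cast this
    have hlt : 2 * halfAngle K < Real.pi / 2 := by
      rw [halfAngle, mul_div_assoc', div_lt_iff₀ (by positivity)]
      nlinarith
    obtain ⟨h1, h2⟩ := hcos (2 * halfAngle K) (by positivity) hlt
    refine (h.isComplexSolution_neg hK hd hdK).ne_zero hK hs hd hdK h1 h2 hz hz0 ?_
    simp only [hP.1, hP.2]
    exact neg_zero

theorem halfAngle_four : halfAngle 4 = Real.pi / 4 := by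
  rw [halfAngle]
  norm_num

/-- For `β = π / 2` the edge values and both interpolation terms are purely imaginary, so `P₁₁` has
zero boundary data. -/
theorem square_left_eq_zero (hd : 0 < d) (hdK : d < Real.sin (halfAngle 4))
    (h : IsSolution 4 s d P₁₁ P₁₂) {z : ℂ} (hz : z ∈ closedPolygon 4) : P₁₁ z = 0 := by
  have hK : 3 ≤ 4 := by norm_num
  refine eq_of_eq_on_edges hK (g := fun _ => 0) h.continuousOn₁₁ continuousOn_const h.harmonic₁₁
    (harmonicOnNhd_const 0) (fun k w hw => ?_) hz
  have h1 := congrArg Complex.re (h.boundary_complex hK hd hdK k w hw)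
  have hβ : 2 * halfAngle 4 = Real.pi / 2 := by rw [halfAngle_four]; ring
  have e1 : Real.cos ((2 * k + 1) * (Real.pi / 2)) = 0 := by
    rw [Real.cos_eq_zero_iff]; exact ⟨k, by ring⟩
  have e2 : ∀ l : ℤ, Real.sin (2 * l * (Real.pi / 2)) = 0 := fun l => by
    rw [Real.sin_eq_zero_iff]; exact ⟨l, by ring⟩
  have e3 := e2 (k + 1)
  push_cast at e3
  have e : boundaryValue 4 s d (2 * halfAngle 4) k w = (s : ℂ) * (rot ((2 * k + 1) * (Real.pi / 2))
      - (tent d (vertex 4 k) w : ℂ) * (Complex.I * rot (2 * k * (Real.pi / 2)))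
      + (tent d (vertex 4 (k + 1)) w : ℂ) * (Complex.I * rot (2 * (k + 1) * (Real.pi / 2)))) := by
    rw [boundaryValue, hβ, Real.sin_pi_div_two]
    push_cast
    ring
  rw [e, Complex.neg_re, Complex.re_ofReal_mul, Complex.add_re, Complex.sub_re,
    Complex.re_ofReal_mul, Complex.re_ofReal_mul, Complex.I_mul_re, Complex.I_mul_re, rot_re,
    rot_im, rot_im, e1, e2, e3] at h1
  simpa using h1

/-- On a diagonal the value is a real multiple of `rot (2m · π / 2) = ±1`, by `eq_on_ray`. -/
theorem square_right_eq_zero (hd : 0 < d) (hdK : d < Real.sin (halfAngle 4))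
    (h : IsSolution 4 s d P₁₁ P₁₂) {m : ℤ} {r : ℝ}
    (hz : (r : ℂ) * rot ((2 * m : ℤ) * halfAngle 4) ∈ closedPolygon 4) :
    P₁₂ (r * rot ((2 * m : ℤ) * halfAngle 4)) = 0 := by
  have hK : 3 ≤ 4 := by norm_num
  have h1 := congrArg Complex.im ((h.isComplexSolution_neg hK hd hdK).eq_on_ray hK (2 * m) hz)
  have h2 : Real.sin ((2 * m : ℤ) * (2 * halfAngle 4)) = 0 := by
    rw [Real.sin_eq_zero_iff]; exact ⟨m, by rw [halfAngle_four]; push_cast; ring⟩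
  rw [Complex.im_ofReal_mul, rot_im, h2, mul_zero] at h1
  simpa using h1

theorem square_diagonals (hd : 0 < d) (hdK : d < Real.sin (halfAngle 4))
    (h : IsSolution 4 s d P₁₁ P₁₂) {z : ℂ} (hz : z ∈ squareDiagonals) :
    z ∈ closedPolygon 4 ∧ P₁₂ z = 0 := by
  have hK : 3 ≤ 4 := by norm_num
  have hzK : z ∈ closedPolygon 4 := by
    rcases hz with hz | hz
    · exact (convex_closedPolygon 4).segment_subset (vertex_mem_closedPolygon 4 0)
        (vertex_mem_closedPolygon 4 2) hz
    · exact (convex_closedPolygon 4).segment_subset (vertex_mem_closedPolygon 4 1)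
        (vertex_mem_closedPolygon 4 3) hz
  refine ⟨hzK, ?_⟩
  have hopp : ∀ k l : ℤ, l = k + 2 → z ∈ segment ℝ (vertex 4 k) (vertex 4 l) → P₁₂ z = 0 := by
    rintro k l rfl ⟨a, b, -, -, -, hab⟩
    have h1 : vertex 4 (k + 2) = -vertex 4 k := by
      have h2 : rot Real.pi = -1 := by apply Complex.ext <;> simp
      rw [vertex_eq_rot, vertex_eq_rot, ← mul_neg_one (rot _), ← h2, rot_mul_rot, halfAngle_four]
      congr 1
      push_cast
      ring
    have hz' : z = ((a - b : ℝ) : ℂ) * rot ((2 * k : ℤ) * halfAngle 4) := by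
      rw [← hab, h1, vertex_eq_rot, Complex.real_smul, Complex.real_smul]
      push_cast
      ring
    rw [hz'] at hzK ⊢
    exact h.square_right_eq_zero hd hdK hzK
  rcases hz with hz | hz
  · exact hopp 0 2 rfl hz
  · exact hopp 1 3 rfl hz

/-- `component_nonneg` admits `cos β = 0`. In the sector of an edge with normal argument `α` it
reads `sin(2α) P₁₂ ≤ 0`, and there `xy` has the sign of `sin(2α)` or vanishes. -/
theorem square_sign (hs : 0 < s) (hd : 0 < d) (hdK : d < Real.sin (halfAngle 4))
    (h : IsSolution 4 s d P₁₁ P₁₂) {z : ℂ} (hz : z ∈ closedPolygon 4) :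
    z.re * z.im * P₁₂ z ≤ 0 := by
  have hK : 3 ≤ 4 := by norm_num
  have hv := h.isComplexSolution_neg hK hd hdK
  have hβ : 2 * halfAngle 4 = Real.pi / 2 := by rw [halfAngle_four]; ring
  obtain ⟨k, hk⟩ := exists_mem_sector_odd hK z
  have hf := hv.component_nonneg hK hs hd hdK (by rw [hβ, Real.cos_pi_div_two])
    (by rw [hβ, Real.cos_pi_div_two]; exact one_pos) ⟨hk, hz⟩
  rw [mem_sector_odd, halfAngle_four, Real.cos_pi_div_four, Real.sin_pi_div_four] at hk
  have hle : |(edgeFrame 4 k z).im| ≤ (edgeFrame 4 k z).re :=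
    le_of_mul_le_mul_right hk (by positivity)
  set α : ℝ := (2 * k + 1) * halfAngle 4 with hα
  have hz2 : z = edgeFrame 4 k z * rot α := (edgeFrame_mul_rot 4 k z).symm
  set u := edgeFrame 4 k z
  have hcos : Real.cos (2 * α) = 0 := by
    rw [Real.cos_eq_zero_iff]; exact ⟨k, by rw [hα, halfAngle_four]; ring⟩
  have hcomp : component (2 * halfAngle 4) (fun z => -(⟨P₁₁ z, P₁₂ z⟩ : ℂ)) (2 * k + 1) z =
      -(Real.sin (2 * α) * P₁₂ z) := by
    have h1 : -(((2 * k + 1 : ℤ) : ℝ) * (2 * halfAngle 4)) = -(2 * α) := by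
      rw [hα]; push_cast; ring
    rw [component, h1, Complex.mul_re, rot_re, rot_im, Real.cos_neg, hcos, Real.sin_neg]
    simp
  rw [hcomp] at hf
  have hxy : 2 * (z.re * z.im) = (u.re ^ 2 - u.im ^ 2) * Real.sin (2 * α) := by
    have h1 : (z ^ 2).im = (u ^ 2 * rot (2 * α)).im := by
      rw [hz2, mul_pow, rot_pow]
      push_cast
      rfl
    rw [Complex.mul_im, rot_re, rot_im, hcos] at h1
    simp only [sq, Complex.mul_re, Complex.mul_im] at h1 ⊢
    linarith
  have hsq : 0 ≤ u.re ^ 2 - u.im ^ 2 := sub_nonneg.2 (sq_le_sq' (by linarith [(abs_le.1 hle).1])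
    (abs_le.1 hle).2)
  have h3 := mul_nonneg hsq hf
  have h4 : 2 * (z.re * z.im * P₁₂ z) = -((u.re ^ 2 - u.im ^ 2) * -(Real.sin (2 * α) * P₁₂ z)) := by
    linear_combination P₁₂ z * hxy
  linarith

theorem isLimitingWORS (hs : 0 < s) (hd : 0 < d) (hdK : d < Real.sin (halfAngle 4))
    (h : IsSolution 4 s d P₁₁ P₁₂) : IsLimitingWORS P₁₁ P₁₂ := by
  -- The scalar is `P₁₂` itself, because `x̂ ⊗ x̂ - ŷ ⊗ ŷ` is the matrix with zero diagonal and
  -- off-diagonal entries `1`; moreover `Y² - X² = -2xy`.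
  refine ⟨P₁₂, h.continuousOn₁₂, h.harmonic₁₂, fun z hz => ?_,
    fun z hz => (h.square_diagonals hd hdK hz).2, fun z hz => ?_⟩
  · have h2 : (Real.sqrt 2)⁻¹ * (Real.sqrt 2)⁻¹ = 1 / 2 := by
      rw [← mul_inv, Real.mul_self_sqrt zero_le_two, one_div]
    rw [h.square_left_eq_zero hd hdK hz]
    ext i j
    fin_cases i <;> fin_cases j <;> simp [pTensor, outer, axisX, axisY, h2] <;> ring
  · have h2 : (Real.sqrt 2)⁻¹ ^ 2 = 1 / 2 := by
      rw [inv_pow, Real.sq_sqrt zero_le_two, one_div]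
    have h3 : inner ℝ axisY z ^ 2 - inner ℝ axisX z ^ 2 = -(2 * (z.re * z.im)) := by
      simp only [Complex.inner, axisX, axisY, Complex.mul_re, Complex.conj_re, Complex.conj_im,
        one_div]
      linear_combination (-4 * (z.re * z.im)) * h2
    rw [h3]
    have := h.square_sign hs hd hdK hz
    linarith

end IsSolution

end NematicPolygon

end

theorem proposition2 (K : ℕ) (hK : 3 ≤ K) (s : ℝ) (hs : 0 < s)
    (d : ℝ) (hd : 0 < d) (hdK : d < Real.sin (Real.pi / K)) :
    -- existence
    (∃ P₁₁ P₁₂ : ℂ → ℝ, NematicPolygon.IsSolution K s d P₁₁ P₁₂) ∧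
    -- uniqueness on the closed polygon
    (∀ P₁₁ P₁₂ R₁₁ R₁₂ : ℂ → ℝ, NematicPolygon.IsSolution K s d P₁₁ P₁₂ →
      NematicPolygon.IsSolution K s d R₁₁ R₁₂ →
      ∀ z ∈ NematicPolygon.closedPolygon K, P₁₁ z = R₁₁ z ∧ P₁₂ z = R₁₂ z) ∧
    -- the zeros of the solution
    (∀ P₁₁ P₁₂ : ℂ → ℝ, NematicPolygon.IsSolution K s d P₁₁ P₁₂ →
      (P₁₁ 0 = 0 ∧ P₁₂ 0 = 0) ∧
      (K ≠ 4 → ∀ z ∈ NematicPolygon.closedPolygon K, z ≠ 0 → (P₁₁ z, P₁₂ z) ≠ (0, 0)) ∧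
      (K = 4 → NematicPolygon.IsLimitingWORS P₁₁ P₁₂ ∧
        ∀ z ∈ NematicPolygon.squareDiagonals, P₁₁ z = 0 ∧ P₁₂ z = 0)) := by
  refine ⟨NematicPolygon.exists_isSolution hK s hd hdK, fun P₁₁ P₁₂ R₁₁ R₁₂ hP hR z hz => ?_,
    fun P₁₁ P₁₂ hP => ⟨hP.apply_zero hK hd hdK,
      fun hK4 z hz hz0 => hP.ne_zero hK hK4 hs hd hdK hz hz0, ?_⟩⟩
  · have h := (hP.isComplexSolution_neg hK hd hdK).eq hK (hR.isComplexSolution_neg hK hd hdK) hz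
    rw [neg_inj] at h
    exact ⟨congrArg Complex.re h, congrArg Complex.im h⟩
  · rintro rfl
    refine ⟨hP.isLimitingWORS hs hd hdK, fun z hz => ?_⟩
    obtain ⟨hzK, h⟩ := hP.square_diagonals hd hdK hz
    exact ⟨hP.square_left_eq_zero hd hdK hzK, h⟩
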